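/- Consider the scalar continuous-time plant $D(\mathcal P)y_p=k_pN(\mathcal P)u_p$, where $\mathcal P=d/dt$, $D$ and $N$ are monic coprime real polynomials of degrees $n_p$ and $m_p<n_p$, $k_p\neq 0$ is a real number of arbitrary sign, and $N$ is Hurwitz. Only $n_p$ and $m_p$ are assumed known. Let $y_m=\frac{k_m}{D_m(\mathcal P)}r$ with $k_m\ne 0$, $D_m$ monic, Hurwitz, of degree $n_p-m_p$, and $r$ a bounded reference, let $e_T=y_p-y_m$, and let $\lambda$ be a monic Hurwitz polynomial of degree $n_p-1$. Put $$\phi_{PE}=\mathrm{col}\Big(\tfrac{1}{\lambda(\mathcal P)}\big(u_p,\dots,u_p^{(n_p-2)},\,y_p,\dots,y_p^{(n_p-2)}\big),\;y_p,\;r\Big)\in\mathbb R^{2n_p},$$ $$\phi_{IE}=\mathrm{col}\Big(\tfrac{1}{D_m(\mathcal P)\lambda(\mathcal P)}\big(u_p,\dots,u_p^{(n_p-2)},\,y_p,\dots,y_p^{(n_p-2)},\,\lambda(\mathcal P)y_p\big),\;\tfrac1{k_m}y_p\Big)\in\mathbb R^{2n_p},\qquad u_{IE}=\tfrac1{D_m(\mathcal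 P)}u_p .$$ There is a vector $\theta\in\mathbb R^{2n_p}$, depending only on $D,N,k_p,D_m,k_m,\lambda$, such that the following holds. (a) If the plant, the reference model and all filters start from zero initial states, then $e_T=\frac{k_p}{D_m(\mathcal P)}\big[u_p-\theta^\top\phi_{PE}\big]$ (from zero initial state) and $u_{IE}(t)=\theta^\top\phi_{IE}(t)$ for all $t\ge0$. (b) For arbitrary initial states of the plant, the reference model and the filters, suppose that the regression $u_{IE}=\theta^\top\phi_{IE}$ holds for all $t\ge 0$ (that is, its exponentially decaying term due to initial conditions is absent), and that it is identifiable: there are times $t_1,\dots,t_{2n_p}>0$ with $\mathrm{rank}\,[\phi_{IE}(t_1)|\cdots|\phi_{IE}(t_{2n_p})]=2n_p$. Let $\gamma>0$, $\gamma_g(t)>0$, and let $\hat\theta_g,\Phi,\hat\theta$ solve on $[0,\infty)$ the G+D interlaced estimator $$\dot{\hat\theta}_g=-\gamma_g\phi_{IE}\big(\phi_{IE}^\top\hat\theta_g-u_{IE}\big),\qquad \dot\Phi=-\gamma_g\phi_{IE}\phi_{IE}^\top\Phi,\ \ \Phi(0)=I_{2n_p},\qquad \dot{\hat\theta}=\gamma\Delta\,(Y-\Delta\hat\theta),$$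 with arbitrary $\hat\theta_g(0)=\theta_{g0}$ and $\hat\theta(0)=\theta_0$, where $\Delta=\det(I_{2n_p}-\Phi)$ and $Y=\mathrm{adj}(I_{2n_p}-\Phi)(\hat\theta_g-\Phi\theta_{g0})$. Then $\hat\theta(t)-\theta\to0$ exponentially as $t\to\infty$. If moreover $u_p(t)=\hat\theta^\top(t)\phi_{PE}(t)$ for all $t\ge0$, then $e_T(t)\to0$ exponentially. -/

import Mathlib

open Polynomial

/-! Continuous-time signals are functions `ℝ → ℝ`, of which only the values at times `t ≥ 0` matter.
`P` denotes the derivative operator `d/dt`. -/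

/-- A real polynomial is Hurwitz if all its complex roots lie in the open left half plane. -/
def IsHurwitz (p : ℝ[X]) : Prop :=
  ∀ z : ℂ, aeval z p = 0 → z.re < 0

/-- `x` is a state trajectory on `[0, ∞)` of the scalar differential equation `p(P) ξ = u`, for a
monic polynomial `p` of degree `d`: the state is `x i = P^i ξ`, `i < d`. The equation is meant in
the integrated (Carathéodory) sense, so that the input `u` only has to be locally integrable. -/
structure IsStateTrajectory (p : ℝ[X]) (u : ℝ → ℝ) (x : ℕ → ℝ → ℝ) : Prop where
  input : ∀ T : ℝ, 0 ≤ T → IntervalIntegrable u MeasureTheory.volume 0 T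
  cont : ∀ i : ℕ, i < p.natDegree → ContinuousOn (x i) (Set.Ici 0)
  chain : ∀ i : ℕ, i + 1 < p.natDegree → ∀ t : ℝ, 0 ≤ t →
    x i t = x i 0 + ∫ s in (0 : ℝ)..t, x (i + 1) s
  top : ∀ i : ℕ, i + 1 = p.natDegree → ∀ t : ℝ, 0 ≤ t →
    x i t = x i 0 +
      ∫ s in (0 : ℝ)..t, (u s - ∑ j ∈ Finset.range p.natDegree, p.coeff j * x j s)

/-- `y` is an output of the linear time-invariant system with the strictly proper transfer function
`q / p` (`p` monic, `deg q < deg p`) and input `u`, from an arbitrary initial state: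
`p(P) ξ = u`, `y = q(P) ξ`. If `p` and `q` are coprime, this is a minimal realization
of the equation `p(P) y = q(P) u`. -/
def Response (q p : ℝ[X]) (u y : ℝ → ℝ) : Prop :=
  ∃ x : ℕ → ℝ → ℝ, IsStateTrajectory p u x ∧
    ∀ t : ℝ, 0 ≤ t → y t = ∑ i ∈ Finset.range p.natDegree, q.coeff i * x i t

/-- `y = (q / p)[u]` with initial state zero. -/
def ZeroStateResponse (q p : ℝ[X]) (u y : ℝ → ℝ) : Prop :=
  ∃ x : ℕ → ℝ → ℝ, IsStateTrajectory p u x ∧ (∀ i : ℕ, i < p.natDegree → x i 0 = 0) ∧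
    ∀ t : ℝ, 0 ≤ t → y t = ∑ i ∈ Finset.range p.natDegree, q.coeff i * x i t

/-- Index set of the `2n` controller parameters: `n - 1` entries for the filtered derivatives of
the input, `n - 1` for those of the output, and one each for the output and the reference. -/
abbrev ParamIdx (n : ℕ) : Type := (Fin (n - 1) ⊕ Fin (n - 1)) ⊕ Fin 2

theorem card_paramIdx (n : ℕ) (hn : 1 ≤ n) : Fintype.card (ParamIdx n) = 2 * n := by
  simp only [ParamIdx, Fintype.card_sum, Fintype.card_fin]
  omega

/-- The signals of the model reference control problem: plant input `u`, plant output `y`, bounded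
reference `r`, output `ym` of the reference model, regressors `φPE` and `φIE`, and filtered input
`uIE`. The relation `R q p v w` says in which sense `w = (q / p)[v]`: it is `Response` (arbitrary
initial states of the plant, the model and all filters) or `ZeroStateResponse`. -/
structure MRACSignals (R : ℝ[X] → ℝ[X] → (ℝ → ℝ) → (ℝ → ℝ) → Prop)
    (n : ℕ) (D N Dm lam : ℝ[X]) (kp km : ℝ)
    (u y r ym : ℝ → ℝ) (φPE φIE : ℝ → ParamIdx n → ℝ) (uIE : ℝ → ℝ) : Prop where
  ref_bounded : ∃ B : ℝ, ∀ t : ℝ, 0 ≤ t → |r t| ≤ B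
  plant : R (C kp * N) D u y
  model : R (C km) Dm r ym
  phiPE_input : ∀ i : Fin (n - 1),
    R (X ^ (i : ℕ)) lam u (fun t => φPE t (Sum.inl (Sum.inl i)))
  phiPE_output : ∀ i : Fin (n - 1),
    R (X ^ (i : ℕ)) lam y (fun t => φPE t (Sum.inl (Sum.inr i)))
  phiPE_y : ∀ t : ℝ, 0 ≤ t → φPE t (Sum.inr 0) = y t
  phiPE_r : ∀ t : ℝ, 0 ≤ t → φPE t (Sum.inr 1) = r t
  phiIE_input : ∀ i : Fin (n - 1),
    R (X ^ (i : ℕ)) (Dm * lam) u (fun t => φIE t (Sum.inl (Sum.inl i)))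
  phiIE_output : ∀ i : Fin (n - 1),
    R (X ^ (i : ℕ)) (Dm * lam) y (fun t => φIE t (Sum.inl (Sum.inr i)))
  phiIE_y : R lam (Dm * lam) y (fun t => φIE t (Sum.inr 0))
  phiIE_last : ∀ t : ℝ, 0 ≤ t → φIE t (Sum.inr 1) = 1 / km * y t
  uIE_eq : R 1 Dm u uIE

/-- The linear regression equation `v(t) = θᵀ φ(t)` for all `t ≥ 0`. -/
def LRE {ι : Type*} [Fintype ι] (v : ℝ → ℝ) (φ : ℝ → ι → ℝ) (θ : ι → ℝ) : Prop :=
  ∀ t : ℝ, 0 ≤ t → v t = θ ⬝ᵥ φ t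

/-- A linear regression equation with regressor `φ(t) ∈ ℝ^q` is identifiable if there are `q`
positive times at which the values of `φ` form a matrix of rank `q`. -/
def Identifiable {ι : Type*} [Fintype ι] (φ : ℝ → ι → ℝ) : Prop :=
  ∃ τ : ι → ℝ, (∀ j, 0 < τ j) ∧
    (Matrix.of fun i j => φ (τ j) i : Matrix ι ι ℝ).rank = Fintype.card ι

/-- `Δ = det (I - Φ)`. -/
noncomputable def gdDelta {ι : Type*} [Fintype ι] [DecidableEq ι] (Φ : Matrix ι ι ℝ) : ℝ :=
  (1 - Φ).det

/-- `Y = adj (I - Φ) (θ_g - Φ θ_g0)`. -/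
noncomputable def gdY {ι : Type*} [Fintype ι] [DecidableEq ι]
    (Φ : Matrix ι ι ℝ) (θg θg0 : ι → ℝ) : ι → ℝ :=
  Matrix.mulVec (1 - Φ).adjugate (θg - Matrix.mulVec Φ θg0)

/-- `(θg, Φ, θhat)` is a solution on `[0, ∞)` of the G+D interlaced estimator with gains `γg`, `γ`
for the regression equation `v = θᵀ φ`; the initial values `θg 0` and `θhat 0` are arbitrary. -/
structure IsGDEstimator {ι : Type*} [Fintype ι] [DecidableEq ι] (γg : ℝ → ℝ) (γ : ℝ)
    (v : ℝ → ℝ) (φ : ℝ → ι → ℝ)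
    (θg : ℝ → ι → ℝ) (Φ : ℝ → Matrix ι ι ℝ) (θhat : ℝ → ι → ℝ) : Prop where
  gradient : ∀ t : ℝ, 0 ≤ t → ∀ i : ι, HasDerivWithinAt (fun s => θg s i)
    (-(γg t) * φ t i * (φ t ⬝ᵥ θg t - v t)) (Set.Ici 0) t
  init : Φ 0 = 1
  fundamental : ∀ t : ℝ, 0 ≤ t → ∀ i j : ι, HasDerivWithinAt (fun s => Φ s i j)
    (-(γg t) * (Matrix.vecMulVec (φ t) (φ t) * Φ t) i j) (Set.Ici 0) t
  estimate : ∀ t : ℝ, 0 ≤ t → ∀ i : ι, HasDerivWithinAt (fun s => θhat s i)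
    (γ * gdDelta (Φ t) * (gdY (Φ t) (θg t) (θg 0) i - gdDelta (Φ t) * θhat t i)) (Set.Ici 0) t

/-- `f(t) → 0` exponentially as `t → ∞`. -/
def ExpConvergesToZero {E : Type*} [NormedAddCommGroup E] (f : ℝ → E) : Prop :=
  ∃ c α : ℝ, 0 < α ∧ ∀ t : ℝ, 0 ≤ t → ‖f t‖ ≤ c * Real.exp (-α * t)

/-! Signals on `[0, ∞)` form a module over `ℂ[X]` in which `X` integrates from `0`. Integrating
`p(P) y = q(P) u` as often as the order `d` of the system gives `rev d p • y = rev d q • u + s •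
step`, where `s` has degree less than `d` and carries the initial state. Transfer function algebra
thus becomes polynomial algebra without differentiating any signal. A reversed monic polynomial acts
injectively (`reflect_smul_injective`), so common factors cancel. A flag `zero` treats zero and
arbitrary initial states together.

The parameter comes from dividing `Dm * lam` by `D`: with quotient `Q` and remainder `R`, put `lam -
a = N Q` and `b + c lam = -R / kp`, so that `(lam - a) D - (b + c lam) kp N = Dm lam N`. Apply this
to the plant state `ξ`, where `u = D ξ` and `y = kp N ξ`. With `v = u - θᵀ φPE` it reads `Dm lam N ξ
= lam (v + (km / kp) r)`, which gives the error equation. Filtered by `1 / (Dm lam)` it is the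
regression `uIE = θᵀ φIE`.

For the estimator, `θg - θ` and `Φ (θg 0 - θ)` solve the same gradient flow from the same initial
value. Hence `Y = Δ θ`, and every component of the estimation error `e` satisfies `ė = -γ Δ² e`.
Once the regressor has spanned the space, `Φ T` strictly shortens every nonzero vector. Lengths
never grow afterwards, so `Φ t` stays in a compact set of matrices without the eigenvalue `1`, and
`|Δ|` is bounded below (`IsGDEstimator.exists_gdDelta_bound`).

For tracking, `Dm lam N` is Hurwitz. The regressor without its reference entry is therefore bounded
by the convolution of `|v|` plus a constant with a decaying exponential (`ExpDominated`). Under the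
control law `|v|` is at most an exponentially decaying factor times the size of the regressor. The
loop gain is then integrable in time, and `le_of_le_add_integral_exp` bounds the regressor. So `v`
decays exponentially, and the tracking error, a stable response to `v`, decays too. -/

open MeasureTheory intervalIntegral in
/-- Integration by parts against the primitive of an integrable function. -/
theorem integral_mul_primitive {G G' h : ℝ → ℂ} (hG : ∀ s, HasDerivAt G (G' s) s)
    (hG' : Continuous G') {t : ℝ} (ht : 0 ≤ t) (hh : IntervalIntegrable h volume 0 t) :
    ∫ s in (0 : ℝ)..t, G' s * ∫ r in (0 : ℝ)..s, h r
      = G t * (∫ r in (0 : ℝ)..t, h r) - ∫ r in (0 : ℝ)..t, G r * h r := by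
  have hint : Integrable h (volume.restrict (Set.Ioc 0 t)) :=
    (intervalIntegrable_iff_integrableOn_Ioc_of_le ht).1 hh
  have hG'i : Integrable G' (volume.restrict (Set.Ioc 0 t)) :=
    (intervalIntegrable_iff_integrableOn_Ioc_of_le ht).1 (hG'.intervalIntegrable 0 t)
  -- Fubini on the triangle `r ≤ s` is used because `h` is only integrable, so its primitive need
  -- not be differentiable everywhere.
  have hmeas : MeasurableSet {p : ℝ × ℝ | p.2 ≤ p.1} := measurableSet_le measurable_snd measurable_fst
  have hprod : Integrable (Function.uncurry fun s r : ℝ => if r ≤ s then G' s * h r else 0)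
      ((volume.restrict (Set.Ioc 0 t)).prod (volume.restrict (Set.Ioc 0 t))) := by
    have := (hG'i.mul_prod hint).indicator hmeas
    refine this.congr (Filter.Eventually.of_forall fun p => ?_)
    simp [Set.indicator, Function.uncurry]
  have key := integral_integral_swap hprod
  have hGcont : Continuous G := continuous_iff_continuousAt.2 fun s => (hG s).continuousAt
  have hGh : IntervalIntegrable (fun r => G r * h r) volume 0 t :=
    hh.continuousOn_mul hGcont.continuousOn
  have e1 : ∫ s in (0 : ℝ)..t, G' s * ∫ r in (0 : ℝ)..s, h r
      = ∫ s in Set.Ioc 0 t, ∫ r in Set.Ioc 0 t, (if r ≤ s then G' s * h r else 0) := by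
    rw [integral_of_le ht]
    refine setIntegral_congr_fun measurableSet_Ioc fun s hs => ?_
    have : ∀ r, (if r ≤ s then G' s * h r else 0)
        = Set.indicator (Set.Iic s) (fun r => G' s * h r) r := fun r => by
      simp [Set.indicator]
    simp only [this]
    rw [setIntegral_indicator measurableSet_Iic, integral_of_le hs.1.le, Set.Ioc_inter_Iic,
      inf_eq_right.2 hs.2, MeasureTheory.integral_const_mul]
  have e2 : ∫ r in Set.Ioc 0 t, ∫ s in Set.Ioc 0 t, (if r ≤ s then G' s * h r else 0)
      = ∫ r in (0 : ℝ)..t, (G t * h r - G r * h r) := by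
    rw [integral_of_le ht]
    refine setIntegral_congr_fun measurableSet_Ioc fun r hr => ?_
    have hae : (fun s => if r ≤ s then G' s * h r else 0)
        = Set.indicator (Set.Ici r) (fun s => G' s * h r) := by
      ext s; simp [Set.indicator]
    simp only [hae]
    rw [setIntegral_indicator measurableSet_Ici]
    have hset : Set.Ioc 0 t ∩ Set.Ici r = Set.Icc r t := by
      ext s; simp only [Set.mem_inter_iff, Set.mem_Ioc, Set.mem_Ici, Set.mem_Icc]
      constructor
      · rintro ⟨⟨_, h2⟩, h3⟩; exact ⟨h3, h2⟩
      · rintro ⟨h1, h2⟩; exact ⟨⟨hr.1.trans_le h1, h2⟩, h1⟩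
    rw [hset, integral_Icc_eq_integral_Ioc, ← integral_of_le hr.2, intervalIntegral.integral_mul_const,
      integral_eq_sub_of_hasDerivAt (fun s _ => hG s) (hG'.intervalIntegrable _ _)]
    ring
  rw [e1, key, e2, intervalIntegral.integral_sub (hh.const_mul _) hGh,
    intervalIntegral.integral_const_mul]

/-! ### Signals as a module over `ℂ[X]` with `X` acting as integration -/

/-- Integrability of a real function on all bounded intervals `[0, T]`. -/
def LocallyIntegrableNonneg (f : ℝ → ℝ) : Prop :=
  ∀ T : ℝ, 0 ≤ T → IntervalIntegrable f MeasureTheory.volume 0 T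

/-- Locally integrable complex signals on `[0, ∞)`, extended by zero to negative times. -/
def signals : Submodule ℂ (ℝ → ℂ) where
  carrier := {f | (∀ t < 0, f t = 0) ∧ ∀ T, 0 ≤ T → IntervalIntegrable f MeasureTheory.volume 0 T}
  add_mem' := fun ha hb => ⟨fun t ht => by simp [ha.1 t ht, hb.1 t ht],
    fun T hT => (ha.2 T hT).add (hb.2 T hT)⟩
  zero_mem' := ⟨fun _ _ => rfl, fun _ _ =>
    intervalIntegrable_const (c := (0 : ℂ))⟩
  smul_mem' := fun c f hf => ⟨fun t ht => by simp [hf.1 t ht], fun T hT => (hf.2 T hT).smul c⟩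

abbrev Signal : Type := signals

namespace Signal

theorem ext_nonneg {f g : Signal} (h : ∀ t, 0 ≤ t → f.1 t = g.1 t) : f = g := by
  apply Subtype.ext
  funext t
  rcases lt_or_ge t 0 with ht | ht
  · rw [f.2.1 t ht, g.2.1 t ht]
  · exact h t ht

theorem intervalIntegrable (f : Signal) {T : ℝ} (hT : 0 ≤ T) :
    IntervalIntegrable f.1 MeasureTheory.volume 0 T := f.2.2 T hT

theorem primitive_continuousOn {h : ℝ → ℂ}
    (hh : ∀ T, 0 ≤ T → IntervalIntegrable h MeasureTheory.volume 0 T) :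
    ContinuousOn (fun t => ∫ s in (0 : ℝ)..t, h s) (Set.Ici 0) := by
  intro t ht
  have hT : (0 : ℝ) ≤ t + 1 := by have : (0 : ℝ) ≤ t := ht; linarith
  have h1 : ContinuousOn (fun t => ∫ s in (0 : ℝ)..t, h s) (Set.uIcc 0 (t + 1)) :=
    intervalIntegral.continuousOn_primitive_interval'
      (hh (t + 1) hT) Set.left_mem_uIcc
  rw [Set.uIcc_of_le hT] at h1
  have hmem : t ∈ Set.Icc 0 (t + 1) := ⟨ht, by linarith⟩
  refine (h1 t hmem).mono_of_mem_nhdsWithin ?_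
  have : Set.Iio (t + 1) ∈ nhds t := Iio_mem_nhds (by linarith)
  filter_upwards [self_mem_nhdsWithin, mem_nhdsWithin_of_mem_nhds this] with s hs hs'
  exact ⟨hs, hs'.le⟩

theorem exp_mul_intervalIntegrable (a : ℂ) (f : Signal) (t : ℝ) {T : ℝ} (hT : 0 ≤ T) :
    IntervalIntegrable (fun s : ℝ => Complex.exp (a * (t - s)) * f.1 s)
      MeasureTheory.volume 0 T :=
  (f.intervalIntegrable hT).continuousOn_mul (by fun_prop)

theorem integral_exp_split (a : ℂ) (f : Signal) (t : ℝ) :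
    ∫ s in (0 : ℝ)..t, Complex.exp (a * (t - s)) * f.1 s
      = Complex.exp (a * t) * ∫ s in (0 : ℝ)..t, Complex.exp (-a * s) * f.1 s := by
  rw [← intervalIntegral.integral_const_mul]
  congr 1
  funext s
  rw [← mul_assoc, ← Complex.exp_add]
  ring_nf

theorem exp_neg_mul_intervalIntegrable (a : ℂ) (f : Signal) {T : ℝ} (hT : 0 ≤ T) :
    IntervalIntegrable (fun s : ℝ => Complex.exp (-a * s) * f.1 s) MeasureTheory.volume 0 T :=
  (f.intervalIntegrable hT).continuousOn_mul (by fun_prop)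

theorem convolution_continuousOn (a : ℂ) (f : Signal) :
    ContinuousOn (fun t : ℝ => ∫ s in (0 : ℝ)..t, Complex.exp (a * (t - s)) * f.1 s)
      (Set.Ici 0) := by
  simp only [integral_exp_split]
  exact ContinuousOn.mul (by fun_prop)
    (primitive_continuousOn fun T hT => exp_neg_mul_intervalIntegrable a f hT)

/-- Convolution with `exp (a t)`. -/
noncomputable def expConv (a : ℂ) : Signal →ₗ[ℂ] Signal where
  toFun f := ⟨fun t : ℝ => ∫ s in (0 : ℝ)..t, Complex.exp (a * (t - s)) * f.1 s, by
    refine ⟨fun t ht => ?_, fun T hT => ?_⟩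
    · beta_reduce
      rw [intervalIntegral.integral_symm, intervalIntegral.integral_of_le ht.le,
        MeasureTheory.integral_Ioc_eq_integral_Ioo,
        MeasureTheory.setIntegral_eq_zero_of_forall_eq_zero, neg_zero]
      intro s hs
      rw [f.2.1 s hs.2, mul_zero]
    · refine ContinuousOn.intervalIntegrable ((convolution_continuousOn a f).mono ?_)
      rw [Set.uIcc_of_le hT]
      exact fun s hs => hs.1⟩
  map_add' f g := by
    refine ext_nonneg fun t ht => ?_
    change ∫ s in (0 : ℝ)..t, Complex.exp (a * (t - s)) * (f.1 s + g.1 s) = _ + _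
    simp only [mul_add]
    exact intervalIntegral.integral_add (exp_mul_intervalIntegrable a f t ht)
      (exp_mul_intervalIntegrable a g t ht)
  map_smul' c f := by
    refine ext_nonneg fun t ht => ?_
    change ∫ s in (0 : ℝ)..t, Complex.exp (a * (t - s)) * (c * f.1 s) = c * _
    rw [← intervalIntegral.integral_const_mul]
    congr 1
    funext s
    ring

theorem expConv_apply (a : ℂ) (f : Signal) (t : ℝ) :
    (expConv a f).1 t = ∫ s in (0 : ℝ)..t, Complex.exp (a * (t - s)) * f.1 s := rfl

theorem expConv_zero_apply (f : Signal) (t : ℝ) :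
    (expConv 0 f).1 t = ∫ s in (0 : ℝ)..t, f.1 s := by
  simp [expConv_apply]

/-- Integration by parts gives this resolvent identity. Together with the reversed order in
`primitive_expConv` it makes `expConv a` act as `X / (1 - a X)`. -/
theorem expConv_primitive (a : ℂ) (f : Signal) :
    a • expConv a (expConv 0 f) = expConv a f - expConv 0 f := by
  refine ext_nonneg fun t ht => ?_
  change a * (expConv a (expConv 0 f)).1 t = (expConv a f).1 t - (expConv 0 f).1 t
  have hd : ∀ s : ℝ, HasDerivAt (fun s : ℝ => -Complex.exp (a * (t - s)))
      (a * Complex.exp (a * (t - s))) s := fun s => by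
    have h1 : HasDerivAt (fun s : ℝ => a * ((t : ℂ) - s)) (a * (0 - 1)) s :=
      ((hasDerivAt_const s (t : ℂ)).sub Complex.ofRealCLM.hasDerivAt).const_mul a
    exact h1.cexp.neg.congr_deriv (by ring)
  have key := integral_mul_primitive hd (by fun_prop) ht (f.intervalIntegrable ht)
  rw [expConv_apply, ← intervalIntegral.integral_const_mul]
  simp only [expConv_zero_apply, ← mul_assoc]
  rw [key]
  simp only [neg_mul, intervalIntegral.integral_neg, sub_self, mul_zero, Complex.exp_zero,
    expConv_apply]
  ring

theorem primitive_expConv (a : ℂ) (f : Signal) :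
    a • expConv 0 (expConv a f) = expConv a f - expConv 0 f := by
  refine ext_nonneg fun t ht => ?_
  change a * (expConv 0 (expConv a f)).1 t = (expConv a f).1 t - (expConv 0 f).1 t
  have hd : ∀ s : ℝ, HasDerivAt (fun s : ℝ => Complex.exp (a * s)) (a * Complex.exp (a * s)) s :=
    fun s => by
    have h1 : HasDerivAt (fun s : ℝ => a * (s : ℂ)) (a * 1) s :=
      Complex.ofRealCLM.hasDerivAt.const_mul a
    exact h1.cexp.congr_deriv (by ring)
  have key := integral_mul_primitive hd (by fun_prop) ht (exp_neg_mul_intervalIntegrable a f ht)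
  rw [expConv_zero_apply, ← intervalIntegral.integral_const_mul]
  simp only [expConv_apply, integral_exp_split, ← mul_assoc]
  rw [key]
  simp only [← mul_assoc, ← Complex.exp_add]
  simp

/-- Signals form a module over `ℂ[X]`, where `X` acts as integration from `0`. -/
noncomputable instance : Module ℂ[X] Signal :=
  Module.compHom Signal (aeval (expConv 0) : ℂ[X] →ₐ[ℂ] Module.End ℂ Signal).toRingHom

theorem poly_smul_def (p : ℂ[X]) (f : Signal) :
    p • f = (aeval (expConv 0) : ℂ[X] →ₐ[ℂ] Module.End ℂ Signal) p f := rfl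

theorem C_smul (a : ℂ) (f : Signal) : (C a : ℂ[X]) • f = a • f := by
  simp [poly_smul_def]

theorem X_smul (f : Signal) : (X : ℂ[X]) • f = expConv 0 f := by
  simp [poly_smul_def]

theorem C_smul_apply (a : ℂ) (f : Signal) (t : ℝ) : ((C a : ℂ[X]) • f).1 t = a * f.1 t := by
  rw [C_smul]; rfl

theorem X_smul_apply (f : Signal) (t : ℝ) : ((X : ℂ[X]) • f).1 t = ∫ s in (0 : ℝ)..t, f.1 s := by
  rw [X_smul, expConv_zero_apply]

theorem add_apply (f g : Signal) (t : ℝ) : (f + g).1 t = f.1 t + g.1 t := rfl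

theorem sub_apply (f g : Signal) (t : ℝ) : (f - g).1 t = f.1 t - g.1 t := rfl

theorem sum_apply {ι : Type*} (s : Finset ι) (f : ι → Signal) (t : ℝ) :
    (∑ i ∈ s, f i).1 t = ∑ i ∈ s, (f i).1 t := by
  have : (∑ i ∈ s, f i).1 = ∑ i ∈ s, (f i).1 := by
    induction s using Finset.cons_induction with
    | empty => rfl
    | cons a s ha ih => rw [Finset.sum_cons, Finset.sum_cons, ← ih]; rfl
  rw [this, Finset.sum_apply]

theorem one_sub_smul_expConv (a : ℂ) (f : Signal) :
    (1 - C a * X : ℂ[X]) • expConv a f = (X : ℂ[X]) • f := by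
  rw [sub_smul, one_smul, mul_smul, X_smul, X_smul, C_smul, primitive_expConv]
  abel

theorem expConv_one_sub_smul (a : ℂ) (f : Signal) :
    expConv a ((1 - C a * X : ℂ[X]) • f) = (X : ℂ[X]) • f := by
  rw [sub_smul, one_smul, mul_smul, X_smul, C_smul, map_sub, map_smul, expConv_primitive]
  abel

/-- Convolution with `exp (a t)` recovers `X • f` from `(1 - a X) • f`, and then `f = (1 - a X) • f
+ a X • f`. -/
theorem one_sub_smul_injective (a : ℂ) {f g : Signal}
    (h : (1 - C a * X : ℂ[X]) • f = (1 - C a * X : ℂ[X]) • g) : f = g := by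
  have hX : (X : ℂ[X]) • f = (X : ℂ[X]) • g := by
    rw [← expConv_one_sub_smul a, ← expConv_one_sub_smul a, h]
  rw [sub_smul, sub_smul, one_smul, one_smul, mul_smul, mul_smul, hX] at h
  exact sub_left_injective h

theorem expConv_smul (a : ℂ) (p : ℂ[X]) (f : Signal) : expConv a (p • f) = p • expConv a f := by
  apply one_sub_smul_injective a
  rw [one_sub_smul_expConv, smul_comm (1 - C a * X) p, one_sub_smul_expConv, smul_comm]

/-- Reversal of the monic linear factor. -/
theorem reflect_X_sub_C_mul (a : ℂ) (p : ℂ[X]) {d : ℕ} (hp : p.natDegree ≤ d) :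
    reflect (d + 1) ((X - C a) * p) = (1 - C a * X) * reflect d p := by
  rw [add_comm d 1, reflect_mul _ _ (natDegree_X_sub_C_le a) hp, reflect_sub, reflect_one_X,
    reflect_C, pow_one]

theorem exists_linear_factor {p : ℂ[X]} {d : ℕ} (hp : p.Monic) (hd : p.natDegree = d + 1) :
    ∃ a : ℂ, ∃ q : ℂ[X], p.IsRoot a ∧ p = (X - C a) * q ∧ q.Monic ∧ q.natDegree = d := by
  obtain ⟨a, ha⟩ := IsAlgClosed.exists_root p (by
    rw [degree_eq_natDegree hp.ne_zero, hd]; exact_mod_cast Nat.succ_ne_zero d)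
  obtain ⟨q, rfl⟩ := dvd_iff_isRoot.2 ha
  have hq : q.Monic := (monic_X_sub_C a).of_mul_monic_left hp
  refine ⟨a, q, ha, rfl, hq, ?_⟩
  rw [(monic_X_sub_C a).natDegree_mul hq, natDegree_X_sub_C] at hd
  omega

/-- Over `ℂ` the reversal splits into factors `1 - a X`, each of them injective. This is the license
to cancel denominators. -/
theorem reflect_smul_injective {p : ℂ[X]} {d : ℕ} (hp : p.Monic) (hd : p.natDegree = d)
    {f g : Signal} (h : reflect d p • f = reflect d p • g) : f = g := by
  induction d generalizing p with
  | zero =>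
    rw [hp.natDegree_eq_zero.1 hd, reflect_one, pow_zero, one_smul, one_smul] at h
    exact h
  | succ d ih =>
    obtain ⟨a, q, -, rfl, hq, hqd⟩ := exists_linear_factor hp hd
    rw [reflect_X_sub_C_mul a q hqd.le, mul_smul, mul_smul] at h
    exact ih hq hqd (one_sub_smul_injective a h)

/-- The signal of a real function on `[0, ∞)`. -/
noncomputable def ofReal (f : ℝ → ℝ) (hf : LocallyIntegrableNonneg f) : Signal :=
  ⟨Set.indicator (Set.Ici 0) fun t => (f t : ℂ), fun t ht => by simp [ht], fun T hT => by
    have h : IntervalIntegrable (fun t => (f t : ℂ)) MeasureTheory.volume 0 T :=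
      ⟨(hf T hT).1.ofReal, (hf T hT).2.ofReal⟩
    refine h.congr ?_
    intro s hs
    rw [Set.uIoc_of_le hT] at hs
    simp [hs.1.le]⟩

theorem ofReal_apply {f : ℝ → ℝ} (hf : LocallyIntegrableNonneg f) {t : ℝ} (ht : 0 ≤ t) :
    (ofReal f hf).1 t = f t := by
  simp [ofReal, ht]

theorem locallyIntegrableNonneg_const (c : ℝ) : LocallyIntegrableNonneg fun _ => c :=
  fun _ _ => intervalIntegrable_const

/-- The unit step. -/
noncomputable def step : Signal := ofReal (fun _ => 1) (locallyIntegrableNonneg_const 1)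

theorem step_apply {t : ℝ} (ht : 0 ≤ t) : step.1 t = 1 := by
  rw [step, ofReal_apply _ ht, Complex.ofReal_one]

/-- Since `1 / (1 - a X) = 1 + a X / (1 - a X)`, this is the free response of a first order factor.
-/
theorem exp_add_expConv_step (a : ℂ) {t : ℝ} (ht : 0 ≤ t) :
    (step + (C a : ℂ[X]) • expConv a step).1 t = Complex.exp (a * t) := by
  rw [add_apply, C_smul_apply, step_apply ht, expConv_apply,
    ← intervalIntegral.integral_const_mul]
  have h : ∀ s ∈ Set.uIcc 0 t, HasDerivAt (fun s : ℝ => -Complex.exp (a * (t - s)))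
      (a * Complex.exp (a * (t - s))) s := fun s _ => by
    have h1 : HasDerivAt (fun s : ℝ => a * ((t : ℂ) - s)) (a * (0 - 1)) s :=
      ((hasDerivAt_const s (t : ℂ)).sub Complex.ofRealCLM.hasDerivAt).const_mul a
    exact h1.cexp.neg.congr_deriv (by ring)
  have h2 := intervalIntegral.integral_eq_sub_of_hasDerivAt h
    (Continuous.intervalIntegrable (by fun_prop) _ _)
  have h3 : ∫ s in (0 : ℝ)..t, a * (Complex.exp (a * (t - s)) * step.1 s)
      = ∫ s in (0 : ℝ)..t, a * Complex.exp (a * (t - s)) := by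
    refine intervalIntegral.integral_congr fun s hs => ?_
    rw [Set.uIcc_of_le ht] at hs
    simp only [step_apply hs.1, mul_one]
  rw [h3, h2]
  simp

end Signal

/-! ### Domination by exponentially weighted integrals, and stable filters -/

namespace Signal

open MeasureTheory

/-- Up to a constant and an exponentially decaying term, `z` is bounded by the convolution of `w`
with a decaying exponential. -/
def ExpDominated (w : ℝ → ℝ) (z : Signal) : Prop :=
  ∃ c α : ℝ, 0 ≤ c ∧ 0 < α ∧ ∀ t : ℝ, 0 ≤ t →
    Real.exp (α * t) * ‖z.1 t‖ ≤ c * (1 + ∫ s in (0 : ℝ)..t, Real.exp (α * s) * w s)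

section

variable {w : ℝ → ℝ}

theorem exp_mul_weight_integrable (hwi : ∀ T : ℝ, 0 ≤ T → IntervalIntegrable w volume 0 T)
    (α : ℝ) {T : ℝ} (hT : 0 ≤ T) :
    IntervalIntegrable (fun s => Real.exp (α * s) * w s) volume 0 T :=
  (hwi T hT).continuousOn_mul (by fun_prop)

theorem weight_integral_nonneg (hw : ∀ t, 0 ≤ t → 0 ≤ w t) (α : ℝ) {t : ℝ} (ht : 0 ≤ t) :
    0 ≤ ∫ s in (0 : ℝ)..t, Real.exp (α * s) * w s :=
  intervalIntegral.integral_nonneg ht fun s hs => mul_nonneg (Real.exp_pos _).le (hw s hs.1)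

theorem weight_integral_mono (hw : ∀ t, 0 ≤ t → 0 ≤ w t)
    (hwi : ∀ T : ℝ, 0 ≤ T → IntervalIntegrable w volume 0 T)
    (α : ℝ) {s t : ℝ} (hs : 0 ≤ s) (hst : s ≤ t) :
    ∫ r in (0 : ℝ)..s, Real.exp (α * r) * w r ≤ ∫ r in (0 : ℝ)..t, Real.exp (α * r) * w r := by
  have h0 := exp_mul_weight_integrable hwi α hs
  have h1 := exp_mul_weight_integrable hwi α (hs.trans hst)
  rw [← intervalIntegral.integral_add_adjacent_intervals h0 (h0.symm.trans h1)]
  have := intervalIntegral.integral_nonneg (μ := volume)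
    (f := fun r => Real.exp (α * r) * w r) hst
    fun r hr => mul_nonneg (Real.exp_pos _).le (hw r (hs.trans hr.1))
  linarith

/-- Multiplying by `exp ((β - α) t)` only helps, since `(β - α) t ≤ (β - α) s` for `s ≤ t`. Bounds
with different rates can thus be brought to a common one. -/
theorem expDominated_of_le_rate (hw : ∀ t, 0 ≤ t → 0 ≤ w t)
    (hwi : ∀ T : ℝ, 0 ≤ T → IntervalIntegrable w volume 0 T)
    {x c α β : ℝ} (hc : 0 ≤ c) (hβα : β ≤ α) {t : ℝ} (ht : 0 ≤ t)
    (h : Real.exp (α * t) * x ≤ c * (1 + ∫ s in (0 : ℝ)..t, Real.exp (α * s) * w s)) :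
    Real.exp (β * t) * x ≤ c * (1 + ∫ s in (0 : ℝ)..t, Real.exp (β * s) * w s) := by
  have e1 : Real.exp (β * t) * x = Real.exp ((β - α) * t) * (Real.exp (α * t) * x) := by
    rw [← mul_assoc, ← Real.exp_add]; ring_nf
  have e2 : Real.exp ((β - α) * t) * (∫ s in (0 : ℝ)..t, Real.exp (α * s) * w s)
      ≤ ∫ s in (0 : ℝ)..t, Real.exp (β * s) * w s := by
    rw [← intervalIntegral.integral_const_mul]
    refine intervalIntegral.integral_mono_on ht
      ((exp_mul_weight_integrable hwi α ht).const_mul _)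
      (exp_mul_weight_integrable hwi β ht) fun s hs => ?_
    rw [← mul_assoc, ← Real.exp_add]
    refine mul_le_mul_of_nonneg_right (Real.exp_le_exp.2 ?_) (hw s hs.1)
    nlinarith [hs.2]
  have e3 : Real.exp ((β - α) * t) ≤ 1 := Real.exp_le_one_iff.2 (by nlinarith)
  rw [e1]
  calc _ ≤ Real.exp ((β - α) * t) *
        (c * (1 + ∫ s in (0 : ℝ)..t, Real.exp (α * s) * w s)) :=
        mul_le_mul_of_nonneg_left h (Real.exp_pos _).le
    _ = c * (Real.exp ((β - α) * t) + Real.exp ((β - α) * t) *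
        ∫ s in (0 : ℝ)..t, Real.exp (α * s) * w s) := by ring
    _ ≤ _ := mul_le_mul_of_nonneg_left (add_le_add e3 e2) hc

theorem ExpDominated.add (hw : ∀ t, 0 ≤ t → 0 ≤ w t)
    (hwi : ∀ T : ℝ, 0 ≤ T → IntervalIntegrable w volume 0 T) {f g : Signal}
    (hf : ExpDominated w f) (hg : ExpDominated w g) : ExpDominated w (f + g) := by
  obtain ⟨c, α, hc, hα, hf⟩ := hf
  obtain ⟨c', α', hc', hα', hg⟩ := hg
  refine ⟨c + c', min α α', add_nonneg hc hc', lt_min hα hα', fun t ht => ?_⟩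
  have h1 := expDominated_of_le_rate hw hwi hc (min_le_left α α') ht (hf t ht)
  have h2 := expDominated_of_le_rate hw hwi hc' (min_le_right α α') ht (hg t ht)
  rw [add_apply]
  have h3 := mul_le_mul_of_nonneg_left (norm_add_le (f.1 t) (g.1 t))
    (Real.exp_pos (min α α' * t)).le
  linarith

theorem ExpDominated.zero : ExpDominated w 0 := by
  refine ⟨0, 1, le_rfl, one_pos, fun t ht => ?_⟩
  change _ * ‖(0 : ℂ)‖ ≤ _
  simp

theorem ExpDominated.C_smul {f : Signal} (a : ℂ) (hf : ExpDominated w f) :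
    ExpDominated w ((C a : ℂ[X]) • f) := by
  obtain ⟨c, α, hc, hα, hf⟩ := hf
  refine ⟨‖a‖ * c, α, by positivity, hα, fun t ht => ?_⟩
  rw [C_smul_apply, norm_mul]
  have := mul_le_mul_of_nonneg_left (hf t ht) (norm_nonneg a)
  linarith

theorem ExpDominated.sum (hw : ∀ t, 0 ≤ t → 0 ≤ w t)
    (hwi : ∀ T : ℝ, 0 ≤ T → IntervalIntegrable w volume 0 T) {ι : Type*} (s : Finset ι)
    {f : ι → Signal} (hf : ∀ i ∈ s, ExpDominated w (f i)) : ExpDominated w (∑ i ∈ s, f i) :=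
  Finset.sum_induction _ (ExpDominated w) (fun _ _ => ExpDominated.add hw hwi)
    (ExpDominated.zero) hf

theorem norm_exp_mul_ofReal (a : ℂ) (x : ℝ) : ‖Complex.exp (a * x)‖ = Real.exp (a.re * x) := by
  rw [Complex.norm_exp]; simp

theorem norm_expConv_le (a : ℂ) (f : Signal) {t : ℝ} (ht : 0 ≤ t) :
    ‖(expConv a f).1 t‖ ≤ ∫ s in (0 : ℝ)..t, Real.exp (a.re * (t - s)) * ‖f.1 s‖ := by
  rw [expConv_apply]
  refine (intervalIntegral.norm_integral_le_integral_norm ht).trans_eq ?_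
  refine intervalIntegral.integral_congr fun s _ => ?_
  simp only [norm_mul]
  rw [← norm_exp_mul_ofReal]
  push_cast
  rfl

theorem exp_mul_norm_expConv_le (a : ℂ) (α : ℝ) (f : Signal) {t : ℝ} (ht : 0 ≤ t) :
    Real.exp (α * t) * ‖(expConv a f).1 t‖
      ≤ ∫ s in (0 : ℝ)..t, Real.exp ((a.re + α) * (t - s)) * (Real.exp (α * s) * ‖f.1 s‖) := by
  refine (mul_le_mul_of_nonneg_left (norm_expConv_le a f ht) (Real.exp_pos _).le).trans_eq ?_
  rw [← intervalIntegral.integral_const_mul]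
  refine intervalIntegral.integral_congr fun s _ => ?_
  rw [← mul_assoc, ← mul_assoc, ← Real.exp_add, ← Real.exp_add]
  ring_nf

/-- At a rate `β` below both `α` and `-a.re`, the weighted convolution kernel `exp ((a.re + β) (t -
s))` is still integrable, while the weighted integral of `w` is monotone in its endpoint and can be
pulled out. -/
theorem ExpDominated.expConv (hw : ∀ t, 0 ≤ t → 0 ≤ w t)
    (hwi : ∀ T : ℝ, 0 ≤ T → IntervalIntegrable w volume 0 T) {f : Signal} {a : ℂ} (ha : a.re < 0)
    (hf : ExpDominated w f) : ExpDominated w (Signal.expConv a f) := by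
  obtain ⟨c, α, hc, hα, hf⟩ := hf
  set β := min α (-a.re / 2) with hβ
  have hβ0 : 0 < β := lt_min hα (by linarith)
  have hμ : a.re + β < 0 := by
    have := min_le_right α (-a.re / 2)
    linarith
  set μ := a.re + β with hμdef
  refine ⟨c * (-1 / μ), β, mul_nonneg hc (div_nonneg_of_nonpos (by norm_num) hμ.le), hβ0,
    fun t ht => ?_⟩
  refine (exp_mul_norm_expConv_le a β f ht).trans ?_
  set I := ∫ s in (0 : ℝ)..t, Real.exp (β * s) * w s with hI
  have hI0 : 0 ≤ I := weight_integral_nonneg hw β ht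
  have hbound : ∀ s ∈ Set.Icc 0 t, Real.exp (μ * (t - s)) * (Real.exp (β * s) * ‖f.1 s‖)
      ≤ Real.exp (μ * (t - s)) * (c * (1 + I)) := fun s hs => by
    refine mul_le_mul_of_nonneg_left ?_ (Real.exp_pos _).le
    refine (expDominated_of_le_rate hw hwi hc (min_le_left _ _) hs.1 (hf s hs.1)).trans ?_
    have := weight_integral_mono hw hwi β hs.1 hs.2
    gcongr
  have hint : IntervalIntegrable
      (fun s => Real.exp (μ * (t - s)) * (Real.exp (β * s) * ‖f.1 s‖)) volume 0 t :=
    ((f.intervalIntegrable ht).norm.continuousOn_mul (by fun_prop)).continuousOn_mul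
      (by fun_prop)
  refine (intervalIntegral.integral_mono_on ht hint
    (Continuous.intervalIntegrable (by fun_prop) _ _) hbound).trans ?_
  have hd : ∀ s ∈ Set.uIcc 0 t, HasDerivAt (fun s : ℝ => (-1 / μ) * Real.exp (μ * (t - s)))
      (Real.exp (μ * (t - s))) s := fun s _ => by
    have h1 : HasDerivAt (fun s : ℝ => μ * (t - s)) (μ * (0 - 1)) s :=
      ((hasDerivAt_const s t).sub (hasDerivAt_id s)).const_mul μ
    refine (h1.exp.const_mul (-1 / μ)).congr_deriv ?_
    field_simp [hμ.ne]
    ring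
  rw [intervalIntegral.integral_mul_const, intervalIntegral.integral_eq_sub_of_hasDerivAt hd
    (Continuous.intervalIntegrable (by fun_prop) _ _)]
  have hneg : 0 < -1 / μ := div_pos_of_neg_of_neg (by norm_num) hμ
  have hexp := Real.exp_pos (μ * (t - 0))
  have hp : 0 ≤ c * (1 + I) := by positivity
  have : -1 / μ * Real.exp (μ * (t - t)) - -1 / μ * Real.exp (μ * (t - 0)) ≤ -1 / μ := by
    rw [sub_self, mul_zero, Real.exp_zero]
    nlinarith
  nlinarith

/-- At the rate `-a.re` the convolution kernel cancels exactly. This turns a pointwise bound by `w`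
into a domination, which is why a strictly proper factor is needed for inputs that are only bounded
pointwise. -/
theorem expDominated_expConv_of_le
    (hwi : ∀ T : ℝ, 0 ≤ T → IntervalIntegrable w volume 0 T) {V : Signal} {a : ℂ} (ha : a.re < 0)
    (hV : ∀ t, 0 ≤ t → ‖V.1 t‖ ≤ w t) : ExpDominated w (Signal.expConv a V) := by
  refine ⟨1, -a.re, zero_le_one, neg_pos.2 ha, fun t ht => ?_⟩
  refine (exp_mul_norm_expConv_le a (-a.re) V ht).trans ?_
  have : ∫ s in (0 : ℝ)..t, Real.exp ((a.re + -a.re) * (t - s)) * (Real.exp (-a.re * s) * ‖V.1 s‖)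
      ≤ ∫ s in (0 : ℝ)..t, Real.exp (-a.re * s) * w s := by
    refine intervalIntegral.integral_mono_on ht ?_ (exp_mul_weight_integrable hwi _ ht)
      fun s hs => ?_
    · exact ((V.intervalIntegrable ht).norm.continuousOn_mul (by fun_prop)).continuousOn_mul
        (by fun_prop)
    · rw [add_neg_cancel, zero_mul, Real.exp_zero, one_mul]
      exact mul_le_mul_of_nonneg_left (hV s hs.1) (Real.exp_pos _).le
  linarith

theorem expDominated_exp (hw : ∀ t, 0 ≤ t → 0 ≤ w t) {a : ℂ} (ha : a.re < 0) :
    ExpDominated w (step + (C a : ℂ[X]) • Signal.expConv a step) := by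
  refine ⟨1, -a.re, zero_le_one, neg_pos.2 ha, fun t ht => ?_⟩
  rw [exp_add_expConv_step a ht, norm_exp_mul_ofReal, ← Real.exp_add]
  have := weight_integral_nonneg hw (-a.re) ht
  simp only [neg_mul, neg_add_cancel, Real.exp_zero]
  simp only [neg_mul] at this
  linarith

theorem sum_X_pow_smul_succ (d : ℕ) (g : ℕ → Signal) :
    ∑ j ∈ Finset.range (d + 1), (X ^ j : ℂ[X]) • g j
      = g 0 + (X : ℂ[X]) • ∑ j ∈ Finset.range d, (X ^ j : ℂ[X]) • g (j + 1) := by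
  rw [Finset.sum_range_succ', Finset.smul_sum, pow_zero, one_smul, add_comm]
  congr 1
  refine Finset.sum_congr rfl fun j _ => ?_
  rw [pow_succ', mul_smul]

/-- Solution of the first order equation. -/
theorem eq_of_one_sub_smul_eq {a : ℂ} {y g h : Signal}
    (hy : (1 - C a * X : ℂ[X]) • y = g + (X : ℂ[X]) • h) :
    y = g + (C a : ℂ[X]) • expConv a g + expConv a h := by
  apply one_sub_smul_injective a
  rw [hy, smul_add, smul_add, one_sub_smul_expConv, smul_comm _ (C a), one_sub_smul_expConv]
  module

/-- Divide by one factor `1 - a X` at a time: the term `g 0` becomes `g 0 + a expConv a (g 0)`, and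
the factor `X` in front of the other terms turns into `expConv a`. Both operations preserve
domination and lower the degree by one. -/
theorem ExpDominated.of_reflect_smul (hw : ∀ t, 0 ≤ t → 0 ≤ w t)
    (hwi : ∀ T : ℝ, 0 ≤ T → IntervalIntegrable w volume 0 T) {d : ℕ} {p : ℂ[X]} (hp : p.Monic)
    (hd : p.natDegree = d) (hroots : ∀ a, p.IsRoot a → a.re < 0) {y : Signal} {g : ℕ → Signal}
    (hg : ∀ j ≤ d, ExpDominated w (g j))
    (h : reflect d p • y = ∑ j ∈ Finset.range (d + 1), (X ^ j : ℂ[X]) • g j) :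
    ExpDominated w y := by
  induction d generalizing p g with
  | zero =>
    rw [hp.natDegree_eq_zero.1 hd, reflect_one, pow_zero, one_smul] at h
    rw [h]
    simpa using hg 0 le_rfl
  | succ d ih =>
    obtain ⟨a, q, ha, rfl, hq, hqd⟩ := exists_linear_factor hp hd
    have hre := hroots a ha
    rw [reflect_X_sub_C_mul a q hqd.le, mul_smul, sum_X_pow_smul_succ] at h
    have h2 := eq_of_one_sub_smul_eq h
    refine ih (g := fun j => (if j = 0 then g 0 + (C a : ℂ[X]) • Signal.expConv a (g 0) else 0)
      + Signal.expConv a (g (j + 1))) hq hqd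
      (fun b hb => hroots b (by rw [IsRoot, eval_mul, hb, mul_zero])) (fun j hj => ?_) ?_
    · refine ExpDominated.add hw hwi ?_ ((hg (j + 1) (by omega)).expConv hw hwi hre)
      split_ifs
      · exact (hg 0 (by omega)).add hw hwi (((hg 0 (by omega)).expConv hw hwi hre).C_smul a)
      · exact ExpDominated.zero
    · rw [h2]
      simp only [smul_add, Finset.sum_add_distrib, map_sum, expConv_smul]
      congr 1
      rw [Finset.sum_range_succ']
      simp

theorem smul_eq_sum_of_natDegree_le {p : ℂ[X]} {d : ℕ} (hp : p.natDegree ≤ d) (f : Signal) :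
    p • f = ∑ j ∈ Finset.range (d + 1), (X ^ j : ℂ[X]) • (C (p.coeff j) : ℂ[X]) • f := by
  conv_lhs => rw [p.as_sum_range_C_mul_X_pow' (Nat.lt_succ_of_le hp)]
  rw [Finset.sum_smul]
  refine Finset.sum_congr rfl fun j _ => ?_
  rw [mul_comm, mul_smul]

theorem natDegree_le_of_mem_degreeLT {p : ℂ[X]} {d : ℕ} (hp : p ∈ degreeLT ℂ (d + 1)) :
    p.natDegree ≤ d := by
  rw [mem_degreeLT, degree_lt_iff_coeff_zero] at hp
  exact natDegree_le_iff_coeff_eq_zero.2 fun m hm => hp m hm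

/-- Output bound for an exponentially stable system with a strictly proper transfer function. -/
theorem ExpDominated.of_stable (hw : ∀ t, 0 ≤ t → 0 ≤ w t)
    (hwi : ∀ T : ℝ, 0 ≤ T → IntervalIntegrable w volume 0 T) {d : ℕ} {p : ℂ[X]} (hp : p.Monic)
    (hd : p.natDegree = d) (hroots : ∀ a, p.IsRoot a → a.re < 0) {y V : Signal} {g : ℕ → Signal}
    {q s : ℂ[X]} (hg : ∀ j ≤ d, ExpDominated w (g j)) (hV : ∀ t, 0 ≤ t → ‖V.1 t‖ ≤ w t)
    (hq : q ∈ degreeLT ℂ d) (hs : s ∈ degreeLT ℂ d)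
    (h : reflect d p • y = ∑ j ∈ Finset.range (d + 1), (X ^ j : ℂ[X]) • g j
      + (X * q) • V + s • step) :
    ExpDominated w y := by
  cases d with
  | zero =>
    have hq0 : q = 0 := by simpa [mem_degreeLT, Nat.WithBot.lt_zero_iff] using hq
    have hs0 : s = 0 := by simpa [mem_degreeLT, Nat.WithBot.lt_zero_iff] using hs
    refine ExpDominated.of_reflect_smul hw hwi hp hd hroots hg ?_
    rw [h, hq0, hs0]
    simp
  | succ d =>
    obtain ⟨a, p', ha, rfl, hp', hpd'⟩ := exists_linear_factor hp hd
    have hre := hroots a ha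
    have hqd : q.natDegree ≤ d := natDegree_le_of_mem_degreeLT hq
    have hsd : s.natDegree ≤ d := natDegree_le_of_mem_degreeLT hs
    rw [reflect_X_sub_C_mul a p' hpd'.le, mul_smul, sum_X_pow_smul_succ] at h
    have h1 : (1 - C a * X : ℂ[X]) • (reflect d p' • y)
        = (g 0 + s • step) + (X : ℂ[X]) •
          ((∑ j ∈ Finset.range (d + 1), (X ^ j : ℂ[X]) • g (j + 1)) + q • V) := by
      rw [h, mul_smul]
      module
    have h2 := eq_of_one_sub_smul_eq h1
    -- One linear factor is spent on `V` and `step`: it turns them into `expConv a V` and `exp (a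
    -- t)`, which are dominated. The remaining factors are handled by the biproper case.
    refine ExpDominated.of_reflect_smul hw hwi (d := d) (p := p')
      (g := fun j => (if j = 0 then g 0 + (C a : ℂ[X]) • Signal.expConv a (g 0) else 0)
        + Signal.expConv a (g (j + 1)) + (C (q.coeff j) : ℂ[X]) • Signal.expConv a V
        + (C (s.coeff j) : ℂ[X]) • (step + (C a : ℂ[X]) • Signal.expConv a step)) hp' hpd'
      (fun b hb => hroots b (by rw [IsRoot, eval_mul, hb, mul_zero])) (fun j hj => ?_) ?_
    · refine (ExpDominated.add hw hwi (ExpDominated.add hw hwi ?_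
        ((hg (j + 1) (by omega)).expConv hw hwi hre))
        ((expDominated_expConv_of_le hwi hre hV).C_smul _)).add hw hwi
        ((expDominated_exp hw hre).C_smul _)
      split_ifs
      · exact (hg 0 (by omega)).add hw hwi (((hg 0 (by omega)).expConv hw hwi hre).C_smul a)
      · exact ExpDominated.zero
    · rw [h2]
      have e1 := smul_eq_sum_of_natDegree_le hqd (Signal.expConv a V)
      have e2 := smul_eq_sum_of_natDegree_le hsd
        (step + (C a : ℂ[X]) • Signal.expConv a step)
      have e3 : ∑ j ∈ Finset.range (d + 1), (X ^ j : ℂ[X]) •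
          (if j = 0 then g 0 + (C a : ℂ[X]) • Signal.expConv a (g 0) else 0)
          = g 0 + (C a : ℂ[X]) • Signal.expConv a (g 0) := by
        rw [Finset.sum_range_succ']
        simp
      simp only [smul_add (X ^ _ : ℂ[X]), Finset.sum_add_distrib] at e1 e2 e3 ⊢
      rw [e3, ← e1, ← e2]
      simp only [map_add, map_sum, expConv_smul, smul_add]
      module

end

end Signal

/-! ### Reversed polynomials and initial-state polynomials -/

theorem ContinuousOn.locallyIntegrableNonneg {f : ℝ → ℝ} (hf : ContinuousOn f (Set.Ici 0)) :
    LocallyIntegrableNonneg f := fun T hT =>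
  (hf.mono (by rw [Set.uIcc_of_le hT]; exact fun s hs => hs.1)).intervalIntegrable

/-- Reversal of a real polynomial of degree at most `d`, with complex coefficients. -/
noncomputable def rev (d : ℕ) (p : ℝ[X]) : ℂ[X] := reflect d (p.map Complex.ofRealHom)

theorem rev_mul {p q : ℝ[X]} {d e : ℕ} (hp : p.natDegree ≤ d) (hq : q.natDegree ≤ e) :
    rev (d + e) (p * q) = rev d p * rev e q := by
  rw [rev, Polynomial.map_mul, reflect_mul _ _ (natDegree_map_le.trans hp)
    (natDegree_map_le.trans hq)]
  rfl

theorem rev_add (d : ℕ) (p q : ℝ[X]) : rev d (p + q) = rev d p + rev d q := by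
  rw [rev, Polynomial.map_add, reflect_add]; rfl

theorem rev_sub (d : ℕ) (p q : ℝ[X]) : rev d (p - q) = rev d p - rev d q := by
  rw [rev, Polynomial.map_sub, reflect_sub]; rfl

theorem rev_C_mul (d : ℕ) (a : ℝ) (p : ℝ[X]) : rev d (C a * p) = C (a : ℂ) * rev d p := by
  rw [rev, Polynomial.map_mul, map_C, reflect_C_mul]; rfl

theorem rev_X_pow {d i : ℕ} (hi : i ≤ d) : rev d (X ^ i) = X ^ (d - i) := by
  rw [rev, Polynomial.map_pow, map_X, reflect_monomial, revAt_le hi]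

theorem rev_one (d : ℕ) : rev d 1 = X ^ d := by
  rw [rev, Polynomial.map_one, reflect_one]

theorem rev_add_left {p : ℝ[X]} {d : ℕ} (hp : p.natDegree ≤ d) (e : ℕ) :
    rev (e + d) p = X ^ e * rev d p := by
  rw [← rev_one, ← rev_mul (by simp) hp, one_mul]

theorem natDegree_rev_le {p : ℝ[X]} {d : ℕ} (hp : p.natDegree ≤ d) : (rev d p).natDegree ≤ d :=
  natDegree_reflect_le.trans (max_le le_rfl (natDegree_map_le.trans hp))

theorem rev_eq_sum {p : ℝ[X]} {d : ℕ} (hp : p.natDegree ≤ d) :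
    rev d p = ∑ j ∈ Finset.range (d + 1), C (p.coeff j : ℂ) * X ^ (d - j) := by
  have key : ∀ s : Finset ℕ, (∀ j ∈ s, j ≤ d) → rev d (∑ j ∈ s, C (p.coeff j) * X ^ j)
      = ∑ j ∈ s, C (p.coeff j : ℂ) * X ^ (d - j) := fun s hs => by
    induction s using Finset.cons_induction with
    | empty => simp [rev]
    | cons a s ha ih =>
      rw [Finset.sum_cons, Finset.sum_cons, rev_add, rev_C_mul,
        rev_X_pow (hs a (Finset.mem_cons_self a s)),
        ih fun j hj => hs j (Finset.mem_cons_of_mem hj)]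
  conv_lhs => rw [p.as_sum_range_C_mul_X_pow' (Nat.lt_succ_of_le hp)]
  exact key _ fun j hj => Nat.lt_succ_iff.1 (Finset.mem_range.1 hj)

/-- Polynomials describing the contribution of the initial state of a system of order `d`: zero
if the initial state is zero, and of degree less than `d` in general. -/
noncomputable def transient (zero : Bool) (d : ℕ) : Submodule ℂ ℂ[X] :=
  bif zero then ⊥ else degreeLT ℂ d

theorem transient_false (d : ℕ) : transient false d = degreeLT ℂ d := by
  simp only [transient, cond_false]

theorem mem_transient_true {d : ℕ} {s : ℂ[X]} : s ∈ transient true d ↔ s = 0 := by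
  simp only [transient, cond_true, Submodule.mem_bot]

theorem transient_le_degreeLT (zero : Bool) (d : ℕ) : transient zero d ≤ degreeLT ℂ d := by
  cases zero
  · rw [transient_false]
  · intro s hs
    rw [mem_transient_true.1 hs]
    exact zero_mem _

theorem transient_mono {zero : Bool} {d e : ℕ} (h : d ≤ e) : transient zero d ≤ transient zero e := by
  cases zero
  · rw [transient_false, transient_false]
    exact degreeLT_mono h
  · intro s hs
    exact mem_transient_true.2 (mem_transient_true.1 hs)

theorem mul_mem_transient {zero : Bool} {k d : ℕ} {p s : ℂ[X]} (hp : p.natDegree ≤ k)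
    (hs : s ∈ transient zero d) : p * s ∈ transient zero (k + d) := by
  cases zero
  · rw [transient_false] at hs ⊢
    rcases eq_or_ne s 0 with rfl | h0
    · rw [mul_zero]; exact zero_mem _
    rcases eq_or_ne p 0 with rfl | hp0
    · rw [zero_mul]; exact zero_mem _
    rw [mem_degreeLT, degree_eq_natDegree h0] at hs
    rw [mem_degreeLT, degree_eq_natDegree (mul_ne_zero hp0 h0), natDegree_mul hp0 h0]
    have : s.natDegree < d := by exact_mod_cast hs
    exact_mod_cast (by omega : p.natDegree + s.natDegree < k + d)
  · rw [mem_transient_true] at hs ⊢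
    rw [hs, mul_zero]

theorem mem_transient_of_X_pow_mul {zero : Bool} {k d : ℕ} {s : ℂ[X]}
    (hs : X ^ k * s ∈ transient zero (k + d)) : s ∈ transient zero d := by
  cases zero
  · rw [transient_false, mem_degreeLT, degree_lt_iff_coeff_zero] at hs ⊢
    intro m hm
    have := hs (m + k) (by omega)
    rwa [coeff_X_pow_mul] at this
  · rw [mem_transient_true] at hs ⊢
    exact (mul_eq_zero.1 hs).resolve_left (pow_ne_zero _ X_ne_zero)

theorem C_mem_transient {zero : Bool} {a : ℂ} (h : zero = true → a = 0) :
    C a ∈ transient zero 1 := by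
  cases zero
  · rw [transient_false, mem_degreeLT]
    exact lt_of_le_of_lt degree_C_le (by norm_num)
  · rw [h rfl, C_0]
    exact zero_mem _

/-- Output of a linear time-invariant system, from an arbitrary or from the zero initial state. -/
def SystemResponse (zero : Bool) (q p : ℝ[X]) (u y : ℝ → ℝ) : Prop :=
  ∃ x : ℕ → ℝ → ℝ, IsStateTrajectory p u x ∧
    (zero = true → ∀ i : ℕ, i < p.natDegree → x i 0 = 0) ∧
    ∀ t : ℝ, 0 ≤ t → y t = ∑ i ∈ Finset.range p.natDegree, q.coeff i * x i t

theorem Response.systemResponse {q p : ℝ[X]} {u y : ℝ → ℝ} (h : Response q p u y) :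
    SystemResponse false q p u y := by
  obtain ⟨x, hx, hy⟩ := h
  exact ⟨x, hx, by simp, hy⟩

theorem ZeroStateResponse.systemResponse {q p : ℝ[X]} {u y : ℝ → ℝ}
    (h : ZeroStateResponse q p u y) : SystemResponse true q p u y := by
  obtain ⟨x, hx, h0, hy⟩ := h
  exact ⟨x, hx, fun _ => h0, hy⟩

/-! ### State chains and integrated input-output equations -/

namespace Signal

/-- The signals `ξ 0, …, ξ d` are successive derivatives, `σ i` collects the contribution of the
initial values to `ξ i`. -/
structure IsChain (zero : Bool) (d : ℕ) (ξ : ℕ → Signal) (σ : ℕ → ℂ[X]) : Prop where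
  succ : ∀ i < d, ∃ c ∈ transient zero 1, ξ i = (X : ℂ[X]) • ξ (i + 1) + c • step
  eq : ∀ i ≤ d, ξ i = (X ^ (d - i) : ℂ[X]) • ξ d + σ i • step
  shift : ∀ i ≤ d, ∃ l ∈ transient zero i, X ^ i * σ i = σ 0 - l
  last : σ d = 0

/-- This is Taylor's formula with integral remainder: `σ i` is the Taylor polynomial of the `i`-th
derivative, with coefficients in the basis `X ^ k • step`. -/
theorem exists_isChain {zero : Bool} {d : ℕ} {ξ : ℕ → Signal} {c : ℕ → ℂ[X]}
    (hc : ∀ i < d, c i ∈ transient zero 1)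
    (hξ : ∀ i < d, ξ i = (X : ℂ[X]) • ξ (i + 1) + c i • step) : ∃ σ, IsChain zero d ξ σ := by
  have hσ : ∀ i < d, (∑ k ∈ Finset.range (d - i), X ^ k * c (i + k))
      = c i + X * ∑ k ∈ Finset.range (d - (i + 1)), X ^ k * c (i + 1 + k) := fun i hi => by
    rw [show d - i = (d - (i + 1)) + 1 by omega, Finset.sum_range_succ', Finset.mul_sum, add_comm]
    simp only [pow_zero, one_mul, add_zero]
    congr 1
    refine Finset.sum_congr rfl fun k _ => ?_
    rw [pow_succ', mul_assoc, add_assoc i 1 k, add_comm 1 k]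
  refine ⟨fun i => ∑ k ∈ Finset.range (d - i), X ^ k * c (i + k),
    fun i hi => ⟨c i, hc i hi, hξ i hi⟩, fun i hi => ?_, fun i => ?_, by simp⟩
  · obtain ⟨k, rfl⟩ := Nat.exists_eq_add_of_le hi
    clear hi
    induction k generalizing i with
    | zero => simp
    | succ k ih =>
      have h1 := ih (i + 1)
      rw [show i + 1 + k = i + (k + 1) by ring] at h1
      rw [hσ i (by omega), hξ i (by omega), h1 hc hξ hσ,
        show i + (k + 1) - i = (i + (k + 1) - (i + 1)) + 1 by omega, pow_succ']
      module
  · induction i with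
    | zero => exact fun _ => ⟨0, zero_mem _, by simp⟩
    | succ i ih =>
      intro hi
      obtain ⟨l, hl, h⟩ := ih (by omega)
      -- The polynomial `l` collects the Taylor terms of `σ 0` of degree below `i + 1`, which `X ^
      -- (i + 1) * σ (i + 1)` lacks.
      refine ⟨l + X ^ i * c i, add_mem (transient_mono (by omega) hl)
        (mul_mem_transient (natDegree_X_pow_le i) (hc i hi)), ?_⟩
      rw [hσ i hi] at h
      rw [pow_succ]
      linear_combination h

theorem IsChain.initial_eq_zero {d : ℕ} {ξ : ℕ → Signal} {σ : ℕ → ℂ[X]}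
    (h : IsChain true d ξ σ) : σ 0 = 0 := by
  obtain ⟨l, hl, hσ⟩ := h.shift d le_rfl
  rw [h.last, mul_zero, mem_transient_true.1 hl, sub_zero] at hσ
  exact hσ.symm

theorem X_smul_apply_of_eq {F : Signal} {f : ℝ → ℝ} (h : ∀ t, 0 ≤ t → F.1 t = f t) {t : ℝ}
    (ht : 0 ≤ t) : ((X : ℂ[X]) • F).1 t = ((∫ s in (0 : ℝ)..t, f s : ℝ) : ℂ) := by
  rw [X_smul_apply, ← intervalIntegral.integral_ofReal]
  refine intervalIntegral.integral_congr fun s hs => ?_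
  rw [Set.uIcc_of_le ht] at hs
  exact h s hs.1

/-- The highest derivative is not part of the state. It is defined by solving `u = p(P) ξ` for its
leading term, and is only locally integrable. -/
theorem exists_chain_of_trajectory {zero : Bool} {p : ℝ[X]} {u : ℝ → ℝ} {x : ℕ → ℝ → ℝ}
    (hp : p.Monic) {d : ℕ} (hd : p.natDegree = d) (hx : IsStateTrajectory p u x)
    (h0 : zero = true → ∀ i : ℕ, i < p.natDegree → x i 0 = 0) (hu : LocallyIntegrableNonneg u) :
    ∃ ξ σ, IsChain zero d ξ σ ∧ (∀ i < d, ∀ t, 0 ≤ t → (ξ i).1 t = x i t) ∧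
      ofReal u hu = ∑ j ∈ Finset.range (d + 1), (C (p.coeff j : ℂ) : ℂ[X]) • ξ j := by
  subst hd
  have hxi : ∀ i < p.natDegree, LocallyIntegrableNonneg (x i) := fun i hi =>
    (hx.cont i hi).locallyIntegrableNonneg
  set b : ℕ → Signal := fun i => if h : i < p.natDegree then ofReal (x i) (hxi i h) else 0 with hb
  have hbx : ∀ i < p.natDegree, ∀ t, 0 ≤ t → (b i).1 t = x i t := fun i hi t ht => by
    simp only [hb, hi, dite_true]
    exact ofReal_apply (hxi i hi) ht
  set w : Signal := ofReal u hu
    - ∑ j ∈ Finset.range p.natDegree, (C (p.coeff j : ℂ) : ℂ[X]) • b j with hw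
  have hwx : ∀ t, 0 ≤ t → w.1 t
      = ((u t - ∑ j ∈ Finset.range p.natDegree, p.coeff j * x j t : ℝ) : ℂ) := fun t ht => by
    rw [hw, sub_apply, ofReal_apply _ ht, sum_apply]
    push_cast
    congr 1
    refine Finset.sum_congr rfl fun j hj => ?_
    rw [C_smul_apply, hbx j (Finset.mem_range.1 hj) t ht]
  set ξ : ℕ → Signal := fun i => if i < p.natDegree then b i else w with hξ
  have hξb : ∀ i < p.natDegree, ξ i = b i := fun i hi => by simp [hξ, hi]
  have hξw : ξ p.natDegree = w := by simp [hξ]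
  obtain ⟨σ, hσ⟩ := exists_isChain (zero := zero) (d := p.natDegree) (ξ := ξ)
    (c := fun i => C (x i 0 : ℂ))
    (fun i hi => C_mem_transient fun hz => by simp [h0 hz i hi])
    (fun i hi => by
      refine ext_nonneg fun t ht => ?_
      rw [add_apply, C_smul_apply, step_apply ht, hξb i hi, hbx i hi t ht]
      rcases Nat.lt_or_ge (i + 1) p.natDegree with h | h
      · rw [hξb _ h, X_smul_apply_of_eq (hbx _ h) ht, hx.chain i h t ht]
        push_cast; ring
      · have he : i + 1 = p.natDegree := by omega
        rw [he, hξw, X_smul_apply_of_eq hwx ht, hx.top i he t ht]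
        push_cast; ring)
  refine ⟨ξ, σ, hσ, fun i hi t ht => by rw [hξb i hi, hbx i hi t ht], ?_⟩
  rw [Finset.sum_range_succ, hξw, hp.coeff_natDegree]
  rw [Finset.sum_congr rfl fun j hj => by rw [hξb j (Finset.mem_range.1 hj)]]
  rw [hw]
  simp

/-- The initial-value term is recorded modulo low degree as a multiple of `σ 0`. When `ξ d` is
eliminated between two outputs of the same chain, `σ 0` drops out and a degree bound remains. -/
theorem IsChain.output {zero : Bool} {d : ℕ} {ξ : ℕ → Signal} {σ : ℕ → ℂ[X]}
    (h : IsChain zero d ξ σ) {q : ℝ[X]} (hq : q.natDegree ≤ d) :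
    ∃ S, ∃ l ∈ transient zero d, X ^ d * S = rev d q * σ 0 - l ∧
      ∑ j ∈ Finset.range (d + 1), (C (q.coeff j : ℂ) : ℂ[X]) • ξ j = rev d q • ξ d + S • step := by
  have hj : ∀ j ∈ Finset.range (d + 1), j ≤ d := fun j hj => by
    have := Finset.mem_range.1 hj; omega
  choose l hl hls using h.shift
  refine ⟨∑ j ∈ Finset.range (d + 1), C (q.coeff j : ℂ) * σ j,
    ∑ j ∈ (Finset.range (d + 1)).attach,
      C (q.coeff j : ℂ) * X ^ (d - (j : ℕ)) * l j (hj j j.2), ?_, ?_, ?_⟩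
  · refine sum_mem fun j _ => ?_
    have := mul_mem_transient (p := C (q.coeff j : ℂ) * X ^ (d - (j : ℕ))) (k := d - j)
      (natDegree_C_mul_X_pow_le _ _) (hl j (hj j j.2))
    rwa [Nat.sub_add_cancel (hj j j.2)] at this
  · rw [rev_eq_sum hq, Finset.mul_sum, Finset.sum_mul, ← Finset.sum_attach,
      ← Finset.sum_attach (Finset.range (d + 1)) fun j => C (q.coeff j : ℂ) * X ^ (d - j) * σ 0,
      ← Finset.sum_sub_distrib]
    refine Finset.sum_congr rfl fun j _ => ?_
    have e : (X ^ d : ℂ[X]) = X ^ (d - (j : ℕ)) * X ^ (j : ℕ) := by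
      rw [← pow_add, Nat.sub_add_cancel (hj j j.2)]
    rw [e]
    linear_combination C (q.coeff j : ℂ) * X ^ (d - (j : ℕ)) * hls j (hj j j.2)
  · rw [rev_eq_sum hq, Finset.sum_smul, Finset.sum_smul, ← Finset.sum_add_distrib]
    refine Finset.sum_congr rfl fun j hjm => ?_
    conv_lhs => rw [h.eq j (hj j hjm)]
    module

end Signal

section

open Signal

theorem SystemResponse.locallyIntegrable_input {zero : Bool} {q p : ℝ[X]} {u y : ℝ → ℝ}
    (h : SystemResponse zero q p u y) : LocallyIntegrableNonneg u := by
  obtain ⟨x, hx, -, -⟩ := h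
  exact hx.input

theorem SystemResponse.continuousOn_output {zero : Bool} {q p : ℝ[X]} {u y : ℝ → ℝ}
    (h : SystemResponse zero q p u y) : ContinuousOn y (Set.Ici 0) := by
  obtain ⟨x, hx, -, hy⟩ := h
  refine ContinuousOn.congr (continuousOn_finsetSum _ fun i hi =>
    continuousOn_const.mul (hx.cont i (Finset.mem_range.1 hi))) fun t ht => hy t ht

theorem SystemResponse.locallyIntegrable_output {zero : Bool} {q p : ℝ[X]} {u y : ℝ → ℝ}
    (h : SystemResponse zero q p u y) : LocallyIntegrableNonneg y :=
  h.continuousOn_output.locallyIntegrableNonneg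

/-- State representation of a response: `u = p(P) ξ` and `y = q(P) ξ`. -/
theorem SystemResponse.exists_chain {zero : Bool} {q p : ℝ[X]} {u y : ℝ → ℝ}
    (h : SystemResponse zero q p u y) (hp : p.Monic) {d : ℕ} (hd : p.natDegree = d)
    (hq : q.natDegree < d) (hu : LocallyIntegrableNonneg u) (hy : LocallyIntegrableNonneg y) :
    ∃ ξ σ, IsChain zero d ξ σ ∧
      ofReal u hu = ∑ j ∈ Finset.range (d + 1), (C (p.coeff j : ℂ) : ℂ[X]) • ξ j ∧
      ofReal y hy = ∑ j ∈ Finset.range (d + 1), (C (q.coeff j : ℂ) : ℂ[X]) • ξ j := by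
  obtain ⟨x, hx, h0, hyx⟩ := h
  obtain ⟨ξ, σ, hσ, hξ, huξ⟩ := exists_chain_of_trajectory hp hd hx h0 hu
  refine ⟨ξ, σ, hσ, huξ, ext_nonneg fun t ht => ?_⟩
  rw [ofReal_apply _ ht, hyx t ht, Finset.sum_range_succ, coeff_eq_zero_of_natDegree_lt hq]
  simp only [Complex.ofReal_zero, C_0, zero_smul, add_zero, sum_apply, C_smul_apply, hd]
  push_cast
  exact Finset.sum_congr rfl fun j hj => by rw [hξ j (Finset.mem_range.1 hj) t ht]

/-- The input-output equation in integrated form. -/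
theorem SystemResponse.rev_smul_eq {zero : Bool} {q p : ℝ[X]} {u y : ℝ → ℝ}
    (h : SystemResponse zero q p u y) (hp : p.Monic) {d : ℕ} (hd : p.natDegree = d)
    (hq : q.natDegree < d) (hu : LocallyIntegrableNonneg u) (hy : LocallyIntegrableNonneg y) :
    ∃ s ∈ transient zero d, rev d p • ofReal y hy = rev d q • ofReal u hu + s • step := by
  obtain ⟨ξ, σ, hσ, hu', hy'⟩ := h.exists_chain hp hd hq hu hy
  obtain ⟨Sp, lp, hlp, hSp, hp'⟩ := hσ.output hd.le
  obtain ⟨Sq, lq, hlq, hSq, hq'⟩ := hσ.output hq.le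
  refine ⟨rev d p * Sq - rev d q * Sp, mem_transient_of_X_pow_mul (k := d) ?_, ?_⟩
  · have e : X ^ d * (rev d p * Sq - rev d q * Sp) = rev d q * lp - rev d p * lq := by
      linear_combination rev d p * hSq - rev d q * hSp
    rw [e]
    exact sub_mem (mul_mem_transient (natDegree_rev_le hq.le) hlp)
      (mul_mem_transient (natDegree_rev_le hd.le) hlq)
  · rw [hu', hy', hp', hq']
    module

end

/-! ### Matching polynomials and the closed loop -/

section

open Signal

theorem exists_matching_polynomials {n m : ℕ} (hmn : m < n) {D N Dm lam : ℝ[X]} {kp : ℝ}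
    (hD : D.Monic) (hDdeg : D.natDegree = n) (hN : N.Monic) (hNdeg : N.natDegree = m)
    (hkp : kp ≠ 0) (hDm : Dm.Monic) (hDmdeg : Dm.natDegree = n - m)
    (hlam : lam.Monic) (hlamdeg : lam.natDegree = n - 1) :
    ∃ a b : ℝ[X], ∃ c : ℝ, a ∈ degreeLT ℝ (n - 1) ∧ b ∈ degreeLT ℝ (n - 1) ∧
      (lam - a) * D - (b + C c * lam) * (C kp * N) = Dm * lam * N := by
  have hM : (Dm * lam).Monic := hDm.mul hlam
  have hMdeg : (Dm * lam).natDegree = n - m + (n - 1) := by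
    rw [hDm.natDegree_mul hlam, hDmdeg, hlamdeg]
  set Q := (Dm * lam) /ₘ D with hQ
  set R := (Dm * lam) %ₘ D with hR
  have hQR : R + D * Q = Dm * lam := modByMonic_add_div _ D
  have hQm : Q.Monic := by
    have : Q.leadingCoeff = (Dm * lam).leadingCoeff :=
      leadingCoeff_divByMonic_of_monic hD (by
        rw [degree_eq_natDegree hD.ne_zero, degree_eq_natDegree hM.ne_zero, hDdeg, hMdeg]
        exact_mod_cast (by omega))
    rw [Monic, this, hM.leadingCoeff]
  have hQdeg : Q.natDegree = n - m - 1 := by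
    rw [hQ, natDegree_divByMonic _ hD, hMdeg, hDdeg]; omega
  have hRdeg : R.degree < n := by
    have := degree_modByMonic_lt (Dm * lam) hD
    rwa [degree_eq_natDegree hD.ne_zero, hDdeg] at this
  have hNQ : (N * Q).Monic := hN.mul hQm
  have hNQdeg : (N * Q).natDegree = n - 1 := by
    rw [hN.natDegree_mul hQm, hNdeg, hQdeg]; omega
  have hlamd : lam.degree = ((n - 1 : ℕ) : WithBot ℕ) := by
    rw [degree_eq_natDegree hlam.ne_zero, hlamdeg]
  set B := C (-1 / kp) * R with hB
  -- Both `lam` and `N * Q` are monic of degree `n - 1`, so their difference has lower degree.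
  -- Subtracting the multiple `B.coeff (n - 1)` of `lam` lowers the degree of `B` in the same way.
  refine ⟨lam - N * Q, B - C (B.coeff (n - 1)) * lam, B.coeff (n - 1), ?_, ?_, ?_⟩
  · rw [mem_degreeLT, ← hlamd]
    refine degree_sub_lt_left ?_ hlam.ne_zero (by rw [hlam.leadingCoeff, hNQ.leadingCoeff])
    rw [degree_eq_natDegree hlam.ne_zero, degree_eq_natDegree hNQ.ne_zero, hlamdeg, hNQdeg]
  · rw [mem_degreeLT, degree_lt_iff_coeff_zero]
    intro k hk
    rw [coeff_sub, coeff_C_mul (p := lam)]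
    rcases eq_or_lt_of_le hk with rfl | hk
    · have : lam.coeff (n - 1) = 1 := by rw [← hlamdeg]; exact hlam
      rw [this, mul_one, sub_self]
    · rw [coeff_eq_zero_of_natDegree_lt (by omega : lam.natDegree < k), hB, coeff_C_mul,
        (degree_lt_iff_coeff_zero R n).1 hRdeg k (by omega)]
      simp
  · have h1 : C (-1 / kp) * C kp = (-1 : ℝ[X]) := by
      rw [← C_mul, div_mul_cancel₀ _ hkp, C_neg, C_1]
    rw [← hQR, hB]
    linear_combination (-R * N) * h1

/-- A combination of the outputs `(P^i / p)[f]` of a filter bank. -/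
theorem filterBank_rev_smul_eq {zero : Bool} {k d : ℕ} {p a : ℝ[X]} {f z : ℝ → ℝ}
    {φ : Fin k → ℝ → ℝ} (hp : p.Monic) (hd : p.natDegree = d) (hkd : k ≤ d)
    (ha : a ∈ degreeLT ℝ k) (hf : LocallyIntegrableNonneg f) (hz : LocallyIntegrableNonneg z)
    (h : ∀ i : Fin k, SystemResponse zero (X ^ (i : ℕ)) p f (φ i))
    (hzφ : ∀ t, 0 ≤ t → z t = ∑ i : Fin k, a.coeff i * φ i t) :
    ∃ s ∈ transient zero d, rev d p • ofReal z hz = rev d a • ofReal f hf + s • step := by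
  have hφ : ∀ i, LocallyIntegrableNonneg (φ i) := fun i => (h i).locallyIntegrable_output
  choose s hs hsφ using fun i : Fin k => (h i).rev_smul_eq hp hd
    (by rw [natDegree_X_pow]; omega) hf (hφ i)
  have hzs : ofReal z hz = ∑ i : Fin k, (C (a.coeff i : ℂ) : ℂ[X]) • ofReal (φ i) (hφ i) := by
    refine ext_nonneg fun t ht => ?_
    rw [ofReal_apply _ ht, Signal.sum_apply, hzφ t ht]
    push_cast
    exact Finset.sum_congr rfl fun i _ => by rw [C_smul_apply, ofReal_apply _ ht]
  rw [mem_degreeLT, degree_lt_iff_coeff_zero] at ha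
  have hrev : rev d a = ∑ i : Fin k, C (a.coeff i : ℂ) * rev d (X ^ (i : ℕ)) := by
    have had : a.natDegree ≤ d := natDegree_le_iff_coeff_eq_zero.2 fun j hj => ha j (by omega)
    rw [rev_eq_sum had, Fin.sum_univ_eq_sum_range (fun i => C (a.coeff i : ℂ) * rev d (X ^ i)) k]
    symm
    rw [← Finset.sum_subset (Finset.range_subset_range.2 (by omega : k ≤ d + 1))]
    · exact Finset.sum_congr rfl fun j hj => by
        rw [rev_X_pow (by have := Finset.mem_range.1 hj; omega)]
    · intro j _ hj
      rw [ha j (by simpa using hj)]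
      simp
  refine ⟨∑ i : Fin k, C (a.coeff i : ℂ) * s i,
    sum_mem fun i _ => ?_, ?_⟩
  · rw [← smul_eq_C_mul]
    exact Submodule.smul_mem _ _ (hs i)
  · rw [hzs, hrev, Finset.smul_sum, Finset.sum_smul, Finset.sum_smul, ← Finset.sum_add_distrib]
    refine Finset.sum_congr rfl fun i _ => ?_
    rw [smul_comm, hsφ i]
    module

/-- Parameter vector with the coefficients of `a` and `b` and the final entries `c` and `c'`. -/
def matchingParam (n : ℕ) (a b : ℝ[X]) (c c' : ℝ) : ParamIdx n → ℝ :=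
  Sum.elim (Sum.elim (fun i => a.coeff i) fun i => b.coeff i) ![c, c']

theorem matchingParam_dotProduct {n : ℕ} (a b : ℝ[X]) (c c' : ℝ) (φ : ParamIdx n → ℝ) :
    matchingParam n a b c c' ⬝ᵥ φ = (∑ i : Fin (n - 1), a.coeff i * φ (Sum.inl (Sum.inl i)))
      + (∑ i : Fin (n - 1), b.coeff i * φ (Sum.inl (Sum.inr i)))
      + (c * φ (Sum.inr 0) + c' * φ (Sum.inr 1)) := by
  simp [dotProduct, matchingParam, Fintype.sum_sum_type]

theorem MRACSignals.mono {R R' : ℝ[X] → ℝ[X] → (ℝ → ℝ) → (ℝ → ℝ) → Prop}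
    (hR : ∀ q p v w, R q p v w → R' q p v w) {n : ℕ} {D N Dm lam : ℝ[X]} {kp km : ℝ}
    {u y r ym : ℝ → ℝ} {φPE φIE : ℝ → ParamIdx n → ℝ} {uIE : ℝ → ℝ}
    (h : MRACSignals R n D N Dm lam kp km u y r ym φPE φIE uIE) :
    MRACSignals R' n D N Dm lam kp km u y r ym φPE φIE uIE where
  ref_bounded := h.ref_bounded
  plant := hR _ _ _ _ h.plant
  model := hR _ _ _ _ h.model
  phiPE_input i := hR _ _ _ _ (h.phiPE_input i)
  phiPE_output i := hR _ _ _ _ (h.phiPE_output i)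
  phiPE_y := h.phiPE_y
  phiPE_r := h.phiPE_r
  phiIE_input i := hR _ _ _ _ (h.phiIE_input i)
  phiIE_output i := hR _ _ _ _ (h.phiIE_output i)
  phiIE_y := hR _ _ _ _ h.phiIE_y
  phiIE_last := h.phiIE_last
  uIE_eq := hR _ _ _ _ h.uIE_eq

theorem LocallyIntegrableNonneg.congr {f g : ℝ → ℝ} (hf : LocallyIntegrableNonneg f)
    (h : ∀ t, 0 ≤ t → f t = g t) : LocallyIntegrableNonneg g := fun T hT =>
  (hf T hT).congr fun s hs => h s (by rw [Set.uIoc_of_le hT] at hs; exact hs.1.le)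

theorem locallyIntegrableNonneg_sum {ι : Type*} (s : Finset ι) (c : ι → ℝ) {f : ι → ℝ → ℝ}
    (hf : ∀ i ∈ s, LocallyIntegrableNonneg (f i)) :
    LocallyIntegrableNonneg fun t => ∑ i ∈ s, c i * f i t := by
  intro T hT
  have := IntervalIntegrable.sum s (f := fun i t => c i * f i t)
    fun i hi => (hf i hi T hT).const_mul (c i)
  refine this.congr fun t _ => ?_
  simp

theorem natDegree_le_of_mem_degreeLT_real {p : ℝ[X]} {d : ℕ} (hp : p ∈ degreeLT ℝ d) :
    p.natDegree ≤ d := by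
  rw [mem_degreeLT, degree_lt_iff_coeff_zero] at hp
  exact natDegree_le_iff_coeff_eq_zero.2 fun k hk => hp k hk.le

section ClosedLoop

variable {zero : Bool} {n m : ℕ} {D N Dm lam a b : ℝ[X]} {kp km c c' : ℝ}
  {u y r ym : ℝ → ℝ} {φPE φIE : ℝ → ParamIdx n → ℝ} {uIE : ℝ → ℝ}

theorem MRACSignals.locallyIntegrable_phiPE
    (h : MRACSignals (SystemResponse zero) n D N Dm lam kp km u y r ym φPE φIE uIE)
    (k : ParamIdx n) : LocallyIntegrableNonneg fun t => φPE t k := by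
  rcases k with (i | i) | i
  · exact (h.phiPE_input i).locallyIntegrable_output
  · exact (h.phiPE_output i).locallyIntegrable_output
  · fin_cases i
    · exact h.plant.locallyIntegrable_output.congr fun t ht => (h.phiPE_y t ht).symm
    · exact h.model.locallyIntegrable_input.congr fun t ht => (h.phiPE_r t ht).symm

theorem MRACSignals.locallyIntegrable_input_error
    (h : MRACSignals (SystemResponse zero) n D N Dm lam kp km u y r ym φPE φIE uIE)
    (θ : ParamIdx n → ℝ) : LocallyIntegrableNonneg fun t => u t - θ ⬝ᵥ φPE t := fun T hT =>
  (h.plant.locallyIntegrable_input T hT).sub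
    (locallyIntegrableNonneg_sum Finset.univ θ (fun k _ => h.locallyIntegrable_phiPE k) T hT)

/-- The control error `u - θᵀ φPE` in terms of the input, the output and the reference. -/
theorem MRACSignals.rev_smul_input_error
    (h : MRACSignals (SystemResponse zero) n D N Dm lam kp km u y r ym φPE φIE uIE)
    (hlam : lam.Monic) (hlamdeg : lam.natDegree = n - 1)
    (ha : a ∈ degreeLT ℝ (n - 1)) (hb : b ∈ degreeLT ℝ (n - 1))
    (hu : LocallyIntegrableNonneg u) (hy : LocallyIntegrableNonneg y)
    (hr : LocallyIntegrableNonneg r)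
    (hv : LocallyIntegrableNonneg fun t => u t - matchingParam n a b c c' ⬝ᵥ φPE t) :
    ∃ s ∈ transient zero (n - 1), rev (n - 1) lam • (ofReal _ hv + (C (c' : ℂ) : ℂ[X]) • ofReal r hr)
      = rev (n - 1) (lam - a) • ofReal u hu - rev (n - 1) (b + C c * lam) • ofReal y hy
        + s • step := by
  have hza := locallyIntegrableNonneg_sum Finset.univ (fun i : Fin (n - 1) => a.coeff i)
    (f := fun i t => φPE t (Sum.inl (Sum.inl i))) fun i _ => h.locallyIntegrable_phiPE _
  have hzb := locallyIntegrableNonneg_sum Finset.univ (fun i : Fin (n - 1) => b.coeff i)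
    (f := fun i t => φPE t (Sum.inl (Sum.inr i))) fun i _ => h.locallyIntegrable_phiPE _
  obtain ⟨s₁, hs₁, h₁⟩ := filterBank_rev_smul_eq hlam hlamdeg le_rfl ha hu hza h.phiPE_input
    fun _ _ => rfl
  obtain ⟨s₂, hs₂, h₂⟩ := filterBank_rev_smul_eq hlam hlamdeg le_rfl hb hy hzb h.phiPE_output
    fun _ _ => rfl
  have hV : ofReal _ hv = ofReal u hu - ofReal _ hza - ofReal _ hzb
      - (C (c : ℂ) : ℂ[X]) • ofReal y hy - (C (c' : ℂ) : ℂ[X]) • ofReal r hr := by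
    refine ext_nonneg fun t ht => ?_
    simp only [sub_apply, C_smul_apply, ofReal_apply _ ht]
    rw [matchingParam_dotProduct, h.phiPE_y t ht, h.phiPE_r t ht]
    push_cast
    ring
  refine ⟨-s₁ - s₂, sub_mem (neg_mem hs₁) hs₂, ?_⟩
  rw [hV, rev_sub, rev_add, rev_C_mul]
  linear_combination (norm := module) -(1 : ℂ[X]) • h₁ - (1 : ℂ[X]) • h₂

/-- The plant state driven by the control error and the reference. -/
theorem MRACSignals.closedLoop
    (h : MRACSignals (SystemResponse zero) n D N Dm lam kp km u y r ym φPE φIE uIE)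
    (hDdeg : D.natDegree = n) (hNdeg : N.natDegree ≤ n)
    (hlam : lam.Monic) (hlamdeg : lam.natDegree = n - 1)
    (ha : a ∈ degreeLT ℝ (n - 1)) (hb : b ∈ degreeLT ℝ (n - 1))
    (hmatch : (lam - a) * D - (b + C c * lam) * (C kp * N) = Dm * lam * N)
    (hu : LocallyIntegrableNonneg u) (hy : LocallyIntegrableNonneg y)
    (hr : LocallyIntegrableNonneg r)
    (hv : LocallyIntegrableNonneg fun t => u t - matchingParam n a b c c' ⬝ᵥ φPE t)
    {ξ : ℕ → Signal} {σ : ℕ → ℂ[X]} (hξ : IsChain zero n ξ σ)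
    (huξ : ofReal u hu = ∑ j ∈ Finset.range (n + 1), (C (D.coeff j : ℂ) : ℂ[X]) • ξ j)
    (hyξ : ofReal y hy = ∑ j ∈ Finset.range (n + 1), (C ((C kp * N).coeff j : ℂ) : ℂ[X]) • ξ j) :
    ∃ S, ∃ l ∈ transient zero (n - 1 + n),
      X ^ n * S = rev (n - 1 + n) (Dm * lam * N) * σ 0 - l ∧
      rev (n - 1) lam • (ofReal _ hv + (C (c' : ℂ) : ℂ[X]) • ofReal r hr)
        = rev (n - 1 + n) (Dm * lam * N) • ξ n + S • step := by
  obtain ⟨s, hs, hs'⟩ := h.rev_smul_input_error hlam hlamdeg ha hb hu hy hr hv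
  have hqdeg : (C kp * N).natDegree ≤ n := (natDegree_C_mul_le _ _).trans hNdeg
  obtain ⟨Su, lu, hlu, hSu, hu'⟩ := hξ.output hDdeg.le
  obtain ⟨Sy, ly, hly, hSy, hy'⟩ := hξ.output hqdeg
  have hα : (lam - a).natDegree ≤ n - 1 :=
    (natDegree_sub_le_of_le hlamdeg.le (natDegree_le_of_mem_degreeLT_real ha)).trans_eq
      (max_self _)
  have hβ : (b + C c * lam).natDegree ≤ n - 1 :=
    natDegree_add_le_of_degree_le (natDegree_le_of_mem_degreeLT_real hb)
      ((natDegree_C_mul_le _ _).trans hlamdeg.le)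
  -- The matching identity holds at the nominal degree `n - 1 + n`. It turns `(lam - a) u - (b + c
  -- lam) y` into `Dm lam N` acting on the plant state.
  have hrev : rev (n - 1 + n) (Dm * lam * N) = rev (n - 1) (lam - a) * rev n D
      - rev (n - 1) (b + C c * lam) * rev n (C kp * N) := by
    rw [← hmatch, rev_sub, rev_mul hα hDdeg.le, rev_mul hβ hqdeg]
  refine ⟨rev (n - 1) (lam - a) * Su - rev (n - 1) (b + C c * lam) * Sy + s,
    rev (n - 1) (lam - a) * lu - rev (n - 1) (b + C c * lam) * ly - X ^ n * s, ?_, ?_, ?_⟩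
  · refine sub_mem (sub_mem (mul_mem_transient (natDegree_rev_le hα) hlu)
      (mul_mem_transient (natDegree_rev_le hβ) hly)) ?_
    rw [add_comm]
    exact mul_mem_transient (natDegree_X_pow_le n) hs
  · rw [hrev]
    linear_combination rev (n - 1) (lam - a) * hSu - rev (n - 1) (b + C c * lam) * hSy
  · rw [hs', huξ, hyξ, hu', hy', hrev]
    module

/-- Any output of the plant state, driven by the control error and the reference. -/
theorem closedLoop_output {p q : ℝ[X]} {k : ℕ} (hp : p.natDegree ≤ k + n) (hq : q.natDegree ≤ n)
    {ξ : ℕ → Signal} {σ : ℕ → ℂ[X]} (hξ : IsChain zero n ξ σ) {Λ S l : ℂ[X]} {G : Signal}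
    (hl : l ∈ transient zero (k + n)) (hS : X ^ n * S = rev (k + n) p * σ 0 - l)
    (hG : Λ • G = rev (k + n) p • ξ n + S • step) :
    ∃ s ∈ transient zero (k + n), rev (k + n) p •
      (∑ j ∈ Finset.range (n + 1), (C (q.coeff j : ℂ) : ℂ[X]) • ξ j)
        = (rev n q * Λ) • G + s • step := by
  obtain ⟨T, lq, hlq, hT, hq'⟩ := hξ.output hq
  refine ⟨rev (k + n) p * T - rev n q * S, mem_transient_of_X_pow_mul (k := n) ?_, ?_⟩
  · have e : X ^ n * (rev (k + n) p * T - rev n q * S) = rev n q * l - rev (k + n) p * lq := by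
      linear_combination rev (k + n) p * hT - rev n q * hS
    rw [e]
    refine sub_mem (mul_mem_transient (natDegree_rev_le hq) hl) ?_
    rw [add_comm n]
    exact mul_mem_transient (natDegree_rev_le hp) hlq
  · rw [hq', mul_smul, hG]
    module

end ClosedLoop

end

/-! ### Zero initial states: error equation and regression -/

section

open Signal

namespace Signal

theorem X_smul_continuousOn (F : Signal) : ContinuousOn ((X : ℂ[X]) • F).1 (Set.Ici 0) :=
  (primitive_continuousOn fun _ hT => F.intervalIntegrable hT).congr fun t _ => X_smul_apply F t

theorem re_X_smul_apply (F : Signal) {t : ℝ} (ht : 0 ≤ t) :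
    (((X : ℂ[X]) • F).1 t).re = ∫ s in (0 : ℝ)..t, (F.1 s).re := by
  rw [X_smul_apply]
  exact (Complex.reCLM.intervalIntegral_comp_comm (F.intervalIntegrable ht)).symm

/-- Realization of a response from the highest derivative of its state. -/
theorem zeroStateResponse_of_rev_smul {p : ℝ[X]} (hp : p.Monic) {d : ℕ} (hd : p.natDegree = d)
    (hd0 : 0 < d) {k : ℝ} {v e : ℝ → ℝ} (hv : LocallyIntegrableNonneg v) {W : Signal}
    (hW : rev d p • W = ofReal v hv)
    (he : ∀ t, 0 ≤ t → (e t : ℂ) = (((C (k : ℂ) * X ^ d : ℂ[X])) • W).1 t) :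
    ZeroStateResponse (C k) p v e := by
  have hX : ∀ i < d, (X ^ (d - i) : ℂ[X]) • W = (X : ℂ[X]) • (X ^ (d - (i + 1)) : ℂ[X]) • W :=
    fun i hi => by rw [← mul_smul, ← pow_succ', show d - (i + 1) + 1 = d - i by omega]
  have h0 : ∀ i < d, (((X ^ (d - i) : ℂ[X]) • W).1 0).re = 0 := fun i hi => by
    rw [hX i hi, re_X_smul_apply _ le_rfl, intervalIntegral.integral_same]
  have hWs : ∀ s, 0 ≤ s → (W.1 s).re
      = v s - ∑ j ∈ Finset.range d, p.coeff j * (((X ^ (d - j) : ℂ[X]) • W).1 s).re := by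
    intro s hs
    have h1 : ofReal v hv = W + ∑ j ∈ Finset.range d,
        (C (p.coeff j : ℂ) : ℂ[X]) • (X ^ (d - j) : ℂ[X]) • W := by
      have hlead : p.coeff d = 1 := by rw [← hd]; exact hp
      rw [← hW, rev_eq_sum hd.le, Finset.sum_range_succ, hlead, add_smul, Finset.sum_smul, add_comm]
      simp [mul_smul]
    have h2 : (v s : ℂ) = W.1 s + ∑ j ∈ Finset.range d,
        (p.coeff j : ℂ) * ((X ^ (d - j) : ℂ[X]) • W).1 s := by
      rw [← ofReal_apply hv hs, h1, add_apply, Signal.sum_apply]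
      simp only [C_smul_apply]
    have h3 := congrArg Complex.re h2
    rw [Complex.add_re, Complex.re_sum] at h3
    simp only [Complex.ofReal_re, Complex.re_ofReal_mul] at h3
    linarith
  subst hd
  -- The `i`-th state is the `(d - i)`-fold integral of the highest derivative `W`. Real parts are
  -- taken because `W` is a complex signal, and they satisfy the same equations as `p` and `v` are
  -- real.
  refine ⟨fun i t => (((X ^ (p.natDegree - i) : ℂ[X]) • W).1 t).re, ⟨hv, ?_, ?_, ?_⟩, h0, ?_⟩
  · intro i hi
    rw [hX i hi]
    exact Complex.continuous_re.comp_continuousOn (X_smul_continuousOn _)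
  · intro i hi t ht
    rw [h0 i (by omega), zero_add, hX i (by omega), re_X_smul_apply _ ht]
  · intro i hi t ht
    rw [h0 i (by omega), zero_add, hX i (by omega), re_X_smul_apply _ ht]
    refine intervalIntegral.integral_congr fun s hs => ?_
    rw [Set.uIcc_of_le ht] at hs
    rw [hi, Nat.sub_self, pow_zero, one_smul]
    exact hWs s hs.1
  · intro t ht
    rw [Finset.sum_eq_single_of_mem 0 (Finset.mem_range.2 hd0)
      fun i _ hi => by rw [coeff_C_of_ne_zero hi, zero_mul], coeff_C_zero]
    beta_reduce
    rw [Nat.sub_zero]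
    have := congrArg Complex.re (he t ht)
    rwa [mul_smul, C_smul_apply, Complex.ofReal_re, Complex.re_ofReal_mul] at this

theorem IsChain.output_zero {d : ℕ} {ξ : ℕ → Signal} {σ : ℕ → ℂ[X]}
    (h : IsChain true d ξ σ) {q : ℝ[X]} (hq : q.natDegree ≤ d) :
    ∑ j ∈ Finset.range (d + 1), (C (q.coeff j : ℂ) : ℂ[X]) • ξ j = rev d q • ξ d := by
  obtain ⟨S, l, hl, hS, hq'⟩ := h.output hq
  rw [mem_transient_true] at hl
  rw [hl, h.initial_eq_zero, mul_zero, sub_zero] at hS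
  rw [hq', (mul_eq_zero.1 hS).resolve_left (pow_ne_zero _ X_ne_zero), zero_smul, add_zero]

end Signal

theorem SystemResponse.rev_smul_eq_zero {q p : ℝ[X]} {u y : ℝ → ℝ}
    (h : SystemResponse true q p u y) (hp : p.Monic) {d : ℕ} (hd : p.natDegree = d)
    (hq : q.natDegree < d) (hu : LocallyIntegrableNonneg u) (hy : LocallyIntegrableNonneg y) :
    rev d p • ofReal y hy = rev d q • ofReal u hu := by
  obtain ⟨s, hs, h⟩ := h.rev_smul_eq hp hd hq hu hy
  rw [h, mem_transient_true.1 hs, zero_smul, add_zero]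

section ZeroState

variable {n m : ℕ} {D N Dm lam a b : ℝ[X]} {kp km c : ℝ}
  {u y r ym : ℝ → ℝ} {φPE φIE : ℝ → ParamIdx n → ℝ} {uIE : ℝ → ℝ}

/-- The tracking error equation for zero initial states. -/
theorem MRACSignals.error_zeroStateResponse
    (h : MRACSignals (SystemResponse true) n D N Dm lam kp km u y r ym φPE φIE uIE)
    (hmn : m < n) (hD : D.Monic) (hDdeg : D.natDegree = n) (hNdeg : N.natDegree = m)
    (hkp : kp ≠ 0) (hDm : Dm.Monic) (hDmdeg : Dm.natDegree = n - m)
    (hlam : lam.Monic) (hlamdeg : lam.natDegree = n - 1)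
    (ha : a ∈ degreeLT ℝ (n - 1)) (hb : b ∈ degreeLT ℝ (n - 1))
    (hmatch : (lam - a) * D - (b + C c * lam) * (C kp * N) = Dm * lam * N) :
    ZeroStateResponse (C kp) Dm
      (fun t => u t - matchingParam n a b c (km / kp) ⬝ᵥ φPE t) fun t => y t - ym t := by
  have hu : LocallyIntegrableNonneg u := h.plant.locallyIntegrable_input
  have hy : LocallyIntegrableNonneg y := h.plant.locallyIntegrable_output
  have hr : LocallyIntegrableNonneg r := h.model.locallyIntegrable_input
  have hym : LocallyIntegrableNonneg ym := h.model.locallyIntegrable_output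
  have hv := h.locallyIntegrable_input_error (matchingParam n a b c (km / kp))
  have hqdeg : (C kp * N).natDegree < n :=
    (natDegree_C_mul_le _ _).trans_lt (hNdeg.trans_lt hmn)
  obtain ⟨ξ, σ, hξ, huξ, hyξ⟩ := h.plant.exists_chain hD hDdeg hqdeg hu hy
  obtain ⟨η, τ, hη, hrη, hymη⟩ := h.model.exists_chain hDm hDmdeg
    (by rw [natDegree_C]; omega) hr hym
  obtain ⟨S, l, hl, hS, hG⟩ := h.closedLoop hDdeg (by omega) hlam hlamdeg ha hb hmatch hu hy hr hv
    hξ huξ hyξ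
  rw [mem_transient_true] at hl
  rw [hl, hξ.initial_eq_zero, mul_zero, sub_zero] at hS
  rw [(mul_eq_zero.1 hS).resolve_left (pow_ne_zero _ X_ne_zero), zero_smul, add_zero] at hG
  rw [hη.output_zero hDmdeg.le] at hrη
  rw [hη.output_zero (by simp)] at hymη
  rw [hξ.output_zero hqdeg.le] at hyξ
  have hn : n = n - m + m := by omega
  have hDmN : (Dm * N).natDegree ≤ n :=
    natDegree_mul_le.trans (by omega)
  have e1 : rev (n - 1 + n) (Dm * lam * N) = rev (n - 1) lam * rev n (Dm * N) := by
    rw [← rev_mul hlamdeg.le hDmN]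
    congr 1; ring
  have e2 : rev n (Dm * N) = rev (n - m) Dm * rev m N := by
    rw [← rev_mul hDmdeg.le hNdeg.le, ← hn]
  have e3 : rev n (C kp * N) = C (kp : ℂ) * X ^ (n - m) * rev m N := by
    rw [rev_C_mul, mul_assoc, ← rev_add_left hNdeg.le, ← hn]
  have e4 : rev (n - m) (C km) = C (km : ℂ) * X ^ (n - m) := by
    rw [← mul_one (C km), rev_C_mul, rev_one]
  have hkk : (C (km : ℂ) : ℂ[X]) = C (kp : ℂ) * C ((km / kp : ℝ) : ℂ) := by
    rw [← C_mul, ← Complex.ofReal_mul, mul_div_cancel₀ _ hkp]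
  rw [e1, mul_smul] at hG
  have hG' := reflect_smul_injective (hlam.map _)
    (by rw [natDegree_map, hlamdeg] : (lam.map Complex.ofRealHom).natDegree = n - 1) hG
  -- The error is driven through the state `N ξ - (km / kp) η`, with `η` the model state; `W` is its
  -- derivative of order `n - m`. The reference cancels because the last parameter is `km / kp`.
  refine zeroStateResponse_of_rev_smul hDm hDmdeg (by omega) hv
    (W := rev m N • ξ n - (C ((km / kp : ℝ) : ℂ) : ℂ[X]) • η (n - m)) ?_ ?_
  · rw [smul_sub, ← mul_smul, ← e2, ← hG', smul_comm, ← hrη, add_sub_cancel_right]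
  · intro t ht
    have : (C (kp : ℂ) * X ^ (n - m) : ℂ[X]) •
        (rev m N • ξ n - (C ((km / kp : ℝ) : ℂ) : ℂ[X]) • η (n - m))
        = ofReal y hy - ofReal ym hym := by
      rw [hyξ, hymη, e3, e4, hkk]
      module
    rw [this, sub_apply, ofReal_apply _ ht, ofReal_apply _ ht]
    push_cast
    rfl

/-- The regression equation for zero initial states. -/
theorem MRACSignals.lre_of_zeroState
    (h : MRACSignals (SystemResponse true) n D N Dm lam kp km u y r ym φPE φIE uIE)
    (hmn : m < n) (hD : D.Monic) (hDdeg : D.natDegree = n) (hNdeg : N.natDegree = m)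
    (hkp : kp ≠ 0) (hkm : km ≠ 0) (hDm : Dm.Monic) (hDmdeg : Dm.natDegree = n - m)
    (hlam : lam.Monic) (hlamdeg : lam.natDegree = n - 1)
    (ha : a ∈ degreeLT ℝ (n - 1)) (hb : b ∈ degreeLT ℝ (n - 1))
    (hmatch : (lam - a) * D - (b + C c * lam) * (C kp * N) = Dm * lam * N) :
    LRE uIE φIE (matchingParam n a b c (km / kp)) := by
  have hu : LocallyIntegrableNonneg u := h.plant.locallyIntegrable_input
  have hy : LocallyIntegrableNonneg y := h.plant.locallyIntegrable_output
  have huI : LocallyIntegrableNonneg uIE := h.uIE_eq.locallyIntegrable_output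
  have hzy : LocallyIntegrableNonneg fun t => φIE t (Sum.inr 0) :=
    h.phiIE_y.locallyIntegrable_output
  have hza := locallyIntegrableNonneg_sum Finset.univ (fun i : Fin (n - 1) => a.coeff i)
    (f := fun i t => φIE t (Sum.inl (Sum.inl i)))
    fun i _ => (h.phiIE_input i).locallyIntegrable_output
  have hzb := locallyIntegrableNonneg_sum Finset.univ (fun i : Fin (n - 1) => b.coeff i)
    (f := fun i t => φIE t (Sum.inl (Sum.inr i)))
    fun i _ => (h.phiIE_output i).locallyIntegrable_output
  have hqdeg : (C kp * N).natDegree < n :=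
    (natDegree_C_mul_le _ _).trans_lt (hNdeg.trans_lt hmn)
  have hpm : (Dm * lam).Monic := hDm.mul hlam
  have hpdeg : (Dm * lam).natDegree = n - m + (n - 1) := by
    rw [hDm.natDegree_mul hlam, hDmdeg, hlamdeg]
  set L := n - m + (n - 1) with hL
  obtain ⟨ξ, σ, hξ, huξ, hyξ⟩ := h.plant.exists_chain hD hDdeg hqdeg hu hy
  rw [hξ.output_zero hqdeg.le] at hyξ
  rw [hξ.output_zero hDdeg.le] at huξ
  obtain ⟨s₁, hs₁, h₁⟩ := filterBank_rev_smul_eq hpm hpdeg (by omega) ha hu hza h.phiIE_input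
    fun _ _ => rfl
  obtain ⟨s₂, hs₂, h₂⟩ := filterBank_rev_smul_eq hpm hpdeg (by omega) hb hy hzb h.phiIE_output
    fun _ _ => rfl
  rw [mem_transient_true.1 hs₁, zero_smul, add_zero] at h₁
  rw [mem_transient_true.1 hs₂, zero_smul, add_zero] at h₂
  have h₃ := h.phiIE_y.rev_smul_eq_zero hpm hpdeg (by omega) hy hzy
  have h₄ := h.uIE_eq.rev_smul_eq_zero hDm hDmdeg (by simp; omega) hu huI
  have e1 : rev L (Dm * lam) = rev (n - 1) lam * rev (n - m) Dm := by
    rw [hL, rev_mul hDmdeg.le hlamdeg.le, mul_comm]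
  have e2 : rev L lam = rev (n - 1) lam * rev (n - m) 1 := by
    rw [hL, rev_add_left hlamdeg.le, rev_one, mul_comm]
  have h₄' : rev L (Dm * lam) • ofReal uIE huI = rev L lam • ofReal u hu := by
    rw [e1, e2, mul_smul, mul_smul, h₄]
  have hα : (lam - a).natDegree ≤ L :=
    (natDegree_sub_le_of_le hlamdeg.le (natDegree_le_of_mem_degreeLT_real ha)).trans
      ((max_self _).trans_le (by omega))
  have hβ : (b + C c * lam).natDegree ≤ L :=
    (natDegree_add_le_of_degree_le (natDegree_le_of_mem_degreeLT_real hb)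
      ((natDegree_C_mul_le _ _).trans hlamdeg.le)).trans (by omega)
  have hkk : (C (1 / kp) : ℝ[X]) * C kp = 1 := by
    rw [← C_mul, one_div_mul_cancel hkp, C_1]
  -- The matching identity with `Dm lam N` rewritten as `(1 / kp) Dm lam (kp N)`. Applied to the top
  -- derivative of the plant state, it is the regression multiplied by `Dm lam`, a factor that is
  -- then cancelled.
  have e3 : (rev L lam - rev L a) * rev n D
      - (rev L b + C (c : ℂ) * rev L lam) * rev n (C kp * N)
      - C ((1 / kp : ℝ) : ℂ) * rev L (Dm * lam) * rev n (C kp * N) = 0 := by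
    rw [← rev_sub, ← rev_C_mul, ← rev_C_mul, ← rev_add, ← rev_mul hα hDdeg.le,
      ← rev_mul hβ hqdeg.le,
      ← rev_mul ((natDegree_C_mul_le _ _).trans hpdeg.le) hqdeg.le, ← rev_sub, ← rev_sub]
    have : (lam - a) * D - (b + C c * lam) * (C kp * N)
        - C (1 / kp) * (Dm * lam) * (C kp * N) = 0 := by
      linear_combination hmatch - (Dm * lam * N) * hkk
    rw [this]
    simp [rev]
  have key : ofReal uIE huI = ofReal _ hza + ofReal _ hzb
      + (C (c : ℂ) : ℂ[X]) • ofReal _ hzy + (C ((1 / kp : ℝ) : ℂ) : ℂ[X]) • ofReal y hy := by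
    refine reflect_smul_injective (hpm.map Complex.ofRealHom)
      (by rw [natDegree_map, hpdeg] : ((Dm * lam).map Complex.ofRealHom).natDegree = L) ?_
    change rev L (Dm * lam) • _ = rev L (Dm * lam) • _
    rw [h₄', smul_add, smul_add, smul_add, h₁, h₂, smul_comm _ (C (c : ℂ)), h₃, huξ, hyξ]
    have e4 : ((rev L lam - rev L a) * rev n D
      - (rev L b + C (c : ℂ) * rev L lam) * rev n (C kp * N)
      - C ((1 / kp : ℝ) : ℂ) * rev L (Dm * lam) * rev n (C kp * N)) • ξ n = 0 := by
      rw [e3, zero_smul]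
    linear_combination (norm := module) e4
  intro t ht
  have ht' := congrArg (fun F : Signal => F.1 t) key
  simp only [Signal.add_apply, C_smul_apply, ofReal_apply _ ht] at ht'
  rw [matchingParam_dotProduct, h.phiIE_last t ht]
  have hc : km / kp * (1 / km * y t) = 1 / kp * y t := by field_simp
  rw [hc]
  rw [← Complex.ofReal_inj, ht']
  push_cast
  ring

end ZeroState

end

/-! ### The G+D estimator -/

section

open Matrix

theorem antitoneOn_Ici_of_hasDerivWithinAt {f f' : ℝ → ℝ} {a : ℝ}
    (hf : ∀ t, a ≤ t → HasDerivWithinAt f (f' t) (Set.Ici a) t) (hf' : ∀ t, a ≤ t → f' t ≤ 0) :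
    AntitoneOn f (Set.Ici a) :=
  antitoneOn_of_hasDerivWithinAt_nonpos (convex_Ici a) (fun t ht => (hf t ht).continuousWithinAt)
    (fun t ht => (hf t (interior_subset ht)).mono interior_subset)
    fun t ht => hf' t (interior_subset ht)

section Estimator

variable {ι : Type*} [Fintype ι]

/-- The gradient flow `ż = -g φ φᵀ z`. -/
def IsGradientFlow (g : ℝ → ℝ) (φ z : ℝ → ι → ℝ) : Prop :=
  ∀ t, 0 ≤ t → ∀ i, HasDerivWithinAt (fun s => z s i) (-(g t) * φ t i * (φ t ⬝ᵥ z t)) (Set.Ici 0) t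

variable {g : ℝ → ℝ} {φ z : ℝ → ι → ℝ}

theorem IsGradientFlow.hasDerivWithinAt_sq (h : IsGradientFlow g φ z) {t : ℝ} (ht : 0 ≤ t) :
    HasDerivWithinAt (fun s => z s ⬝ᵥ z s) (-2 * g t * (φ t ⬝ᵥ z t) ^ 2) (Set.Ici 0) t := by
  have h1 := HasDerivWithinAt.fun_sum (u := Finset.univ) fun i _ => (h t ht i).mul (h t ht i)
  refine h1.congr_deriv ?_
  have : (φ t ⬝ᵥ z t) ^ 2 = ∑ i, φ t i * z t i * (φ t ⬝ᵥ z t) := by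
    rw [← Finset.sum_mul, pow_two]; rfl
  rw [this, Finset.mul_sum]
  exact Finset.sum_congr rfl fun i _ => by ring

theorem IsGradientFlow.antitoneOn (h : IsGradientFlow g φ z) (hg : ∀ t, 0 ≤ t → 0 < g t) :
    AntitoneOn (fun s => z s ⬝ᵥ z s) (Set.Ici 0) :=
  antitoneOn_Ici_of_hasDerivWithinAt (fun _ ht => h.hasDerivWithinAt_sq ht) fun t ht => by
    have := mul_nonneg (hg t ht).le (sq_nonneg (φ t ⬝ᵥ z t))
    linarith

/-- The squared length never increases. By linearity this gives uniqueness for the flow without any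
regularity of `φ` or the gain. -/
theorem IsGradientFlow.eq_zero (h : IsGradientFlow g φ z) (hg : ∀ t, 0 ≤ t → 0 < g t)
    (h0 : z 0 = 0) {t : ℝ} (ht : 0 ≤ t) : z t = 0 := by
  have := h.antitoneOn hg (Set.mem_Ici.2 le_rfl) ht ht
  simp only [h0, dotProduct_zero] at this
  exact dotProduct_self_eq_zero.1
    (le_antisymm this (Finset.sum_nonneg fun i _ => mul_self_nonneg _))

theorem Identifiable.eq_zero {τ : ι → ℝ} {w : ι → ℝ}
    (hrank : (Matrix.of fun i j => φ (τ j) i : Matrix ι ι ℝ).rank = Fintype.card ι)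
    (hw : ∀ j, φ (τ j) ⬝ᵥ w = 0) : w = 0 := by
  set M : Matrix ι ι ℝ := Matrix.of fun i j => φ (τ j) i
  have hr : Module.finrank ℝ (LinearMap.range (Mᵀ).mulVecLin) = Module.finrank ℝ (ι → ℝ) := by
    rw [Module.finrank_fintype_fun_eq_card, ← hrank, ← Matrix.rank_transpose]
    rfl
  have hsurj : Function.Surjective (Mᵀ).mulVecLin :=
    LinearMap.range_eq_top.1 (Submodule.eq_top_of_finrank_eq hr)
  have hinj := LinearMap.injective_iff_surjective.2 hsurj
  apply hinj
  rw [map_zero]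
  funext j
  exact hw j

/-- Strict contraction of the gradient flow once the regressor has spanned the space. -/
theorem IsGradientFlow.sq_lt (h : IsGradientFlow g φ z) (hg : ∀ t, 0 ≤ t → 0 < g t)
    {τ : ι → ℝ} (hτ : ∀ j, 0 < τ j)
    (hrank : (Matrix.of fun i j => φ (τ j) i : Matrix ι ι ℝ).rank = Fintype.card ι)
    {T : ℝ} (hT : 0 ≤ T) (hτT : ∀ j, τ j < T) (h0 : z 0 ≠ 0) : z T ⬝ᵥ z T < z 0 ⬝ᵥ z 0 := by
  -- Without a strict decrease the length is constant on `[0, T]`. Its derivative then forces `φᵀ z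
  -- = 0`, so `z` does not move and `z 0` is orthogonal to all the spanning vectors `φ (τ j)`.
  by_contra hcon
  have hanti := h.antitoneOn hg
  have hconst : ∀ t ∈ Set.Icc 0 T, z t ⬝ᵥ z t = z 0 ⬝ᵥ z 0 := fun t ht =>
    le_antisymm (hanti (Set.mem_Ici.2 le_rfl) ht.1 ht.1)
      ((not_lt.1 hcon).trans (hanti ht.1 hT ht.2))
  have hzero : ∀ t ∈ Set.Ico 0 T, φ t ⬝ᵥ z t = 0 := fun t ht => by
    have h1 := (h.hasDerivWithinAt_sq ht.1).mono (Set.Ici_subset_Ici.2 ht.1)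
    have h2 : HasDerivWithinAt (fun s => z s ⬝ᵥ z s) 0 (Set.Ici t) t := by
      refine (hasDerivWithinAt_const t (Set.Ici t) (z 0 ⬝ᵥ z 0)).congr_of_eventuallyEq ?_
        (hconst t ⟨ht.1, ht.2.le⟩)
      filter_upwards [self_mem_nhdsWithin, mem_nhdsWithin_of_mem_nhds (Iio_mem_nhds ht.2)]
        with s hs hs'
      exact hconst s ⟨ht.1.trans hs, le_of_lt hs'⟩
    have h3 := (uniqueDiffOn_Ici t t (Set.mem_Ici.2 le_rfl)).eq_deriv _ h1 h2
    have h4 : g t * (φ t ⬝ᵥ z t) ^ 2 = 0 := by linarith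
    exact pow_eq_zero_iff two_ne_zero |>.1 ((mul_eq_zero.1 h4).resolve_left (hg t ht.1).ne')
  have hz : ∀ t ∈ Set.Icc 0 T, z t = z 0 := fun t ht => funext fun i => by
    refine constant_of_has_deriv_right_zero (f := fun s => z s i)
      (fun s hs => ((h s hs.1 i).continuousWithinAt).mono Set.Icc_subset_Ici_self)
      (fun s hs => ?_) t ht
    have := (h s hs.1 i).mono (Set.Ici_subset_Ici.2 hs.1)
    rwa [hzero s hs, mul_zero] at this
  refine h0 (Identifiable.eq_zero hrank fun j => ?_)
  rw [← hz (τ j) ⟨(hτ j).le, (hτT j).le⟩]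
  exact hzero _ ⟨(hτ j).le, hτT j⟩

variable [DecidableEq ι] {γ : ℝ} {v : ℝ → ℝ} {θg θhat : ℝ → ι → ℝ} {Φ : ℝ → Matrix ι ι ℝ}
  {θ : ι → ℝ}

theorem IsGDEstimator.isGradientFlow_mulVec (h : IsGDEstimator g γ v φ θg Φ θhat) (w : ι → ℝ) :
    IsGradientFlow g φ fun t => Φ t *ᵥ w := fun t ht i => by
  have h1 := HasDerivWithinAt.fun_sum (u := Finset.univ)
    fun j _ => (h.fundamental t ht i j).mul_const (w j)
  refine h1.congr_deriv ?_
  have : φ t i * (φ t ⬝ᵥ Φ t *ᵥ w) = ((vecMulVec (φ t) (φ t) * Φ t) *ᵥ w) i := by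
    rw [← mulVec_mulVec, vecMulVec_mulVec]
    simp
  rw [mul_assoc, this, mulVec, dotProduct, Finset.mul_sum]
  exact Finset.sum_congr rfl fun j _ => by ring

/-- The gradient estimate determines the parameter through the fundamental matrix. -/
theorem IsGDEstimator.gdY_eq (h : IsGDEstimator g γ v φ θg Φ θhat) (hg : ∀ t, 0 ≤ t → 0 < g t)
    (hv : LRE v φ θ) {t : ℝ} (ht : 0 ≤ t) : gdY (Φ t) (θg t) (θg 0) = gdDelta (Φ t) • θ := by
  -- Both `θg - θ` and `Φ (θg 0 - θ)` solve the flow and agree at time `0`, where `Φ` is the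
  -- identity.
  have hflow : IsGradientFlow g φ fun t => θg t - θ - Φ t *ᵥ (θg 0 - θ) := fun t ht i => by
    have h1 := ((h.gradient t ht i).sub_const (θ i)).sub
      (h.isGradientFlow_mulVec (θg 0 - θ) t ht i)
    refine h1.congr_deriv ?_
    rw [hv t ht, dotProduct_sub, dotProduct_sub, dotProduct_comm θ]
    ring
  have h0 := hflow.eq_zero hg (by simp [h.init]) ht
  have h1 : θg t - Φ t *ᵥ θg 0 = (1 - Φ t) *ᵥ θ := by
    rw [mulVec_sub] at h0
    rw [sub_mulVec, one_mulVec]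
    linear_combination (norm := module) h0
  rw [gdY, h1, mulVec_mulVec, adjugate_mul, smul_mulVec, one_mulVec, gdDelta]

/-- A kernel vector of `1 - A` is fixed by `A`, so its length would not shrink. -/
theorem det_one_sub_ne_zero_of_sq_lt {A : Matrix ι ι ℝ}
    (hA : ∀ w, w ≠ 0 → (A *ᵥ w) ⬝ᵥ (A *ᵥ w) < w ⬝ᵥ w) : (1 - A).det ≠ 0 := fun h => by
  obtain ⟨w, hw, hw'⟩ := exists_mulVec_eq_zero_iff.2 h
  rw [sub_mulVec, one_mulVec, sub_eq_zero] at hw'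
  have := hA w hw
  rw [← hw'] at this
  exact lt_irrefl _ this

/-- Testing on the standard basis bounds the columns, and the conditions are closed. The set
contains every later value of the fundamental matrix, so no convergence of `Φ` is needed to bound
the determinant below. -/
theorem isCompact_setOf_sq_le (B : Matrix ι ι ℝ) :
    IsCompact {A : Matrix ι ι ℝ | ∀ w, (A *ᵥ w) ⬝ᵥ (A *ᵥ w) ≤ (B *ᵥ w) ⬝ᵥ (B *ᵥ w)} := by
  -- The summand `1` gives `x ^ 2 + 1 ≤ c j` for each entry `x` of column `j`, hence `|x| ≤ c j`
  -- without square roots.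
  set c : ι → ℝ := fun j => 1 + (B *ᵥ Pi.single j 1) ⬝ᵥ (B *ᵥ Pi.single j 1) with hc
  have hK : IsCompact (Set.pi Set.univ fun _ : ι => Set.pi Set.univ fun j : ι =>
      Set.Icc (-c j) (c j)) :=
    isCompact_univ_pi fun _ => isCompact_univ_pi fun _ => isCompact_Icc
  refine IsCompact.of_isClosed_subset hK ?_ ?_
  · simp only [Set.ofPred_forall]
    refine isClosed_iInter fun w => isClosed_le ?_ continuous_const
    have : Continuous fun A : Matrix ι ι ℝ => A *ᵥ w := continuous_id.matrix_mulVec continuous_const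
    exact this.dotProduct this
  · intro A hA i _ j _
    have h1 := hA (Pi.single j 1)
    have h2 : (A *ᵥ Pi.single j 1) i = A i j := by simp
    have h3 : A i j * A i j ≤ (A *ᵥ Pi.single j 1) ⬝ᵥ (A *ᵥ Pi.single j 1) := by
      rw [← h2]
      exact Finset.single_le_sum (f := fun i => (A *ᵥ Pi.single j 1) i * (A *ᵥ Pi.single j 1) i)
        (fun i _ => mul_self_nonneg _) (Finset.mem_univ i)
    have h4 : A i j * A i j + 1 ≤ c j := by rw [hc]; linarith
    constructor <;> nlinarith [sq_nonneg (A i j + 1), sq_nonneg (A i j - 1), mul_self_nonneg (A i j)]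

/-- The determinant is eventually bounded away from zero. -/
theorem IsGDEstimator.exists_gdDelta_bound (h : IsGDEstimator g γ v φ θg Φ θhat)
    (hg : ∀ t, 0 ≤ t → 0 < g t) (hid : Identifiable φ) :
    ∃ T δ : ℝ, 0 ≤ T ∧ 0 < δ ∧ ∀ t, T ≤ t → δ ≤ |gdDelta (Φ t)| := by
  obtain ⟨τ, hτ, hrank⟩ := hid
  set T := 1 + ∑ j, τ j with hTdef
  have hT : 0 ≤ T := add_nonneg zero_le_one (Finset.sum_nonneg fun j _ => (hτ j).le)
  have hτT : ∀ j, τ j < T := fun j => by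
    have := Finset.single_le_sum (f := τ) (fun j _ => (hτ j).le) (Finset.mem_univ j)
    linarith
  have hlt : ∀ w, w ≠ 0 → (Φ T *ᵥ w) ⬝ᵥ (Φ T *ᵥ w) < w ⬝ᵥ w := fun w hw => by
    have := (h.isGradientFlow_mulVec w).sq_lt hg hτ hrank hT hτT (by simpa [h.init] using hw)
    simpa [h.init] using this
  have hmem : ∀ t, T ≤ t → Φ t ∈ {A : Matrix ι ι ℝ | ∀ w,
      (A *ᵥ w) ⬝ᵥ (A *ᵥ w) ≤ (Φ T *ᵥ w) ⬝ᵥ (Φ T *ᵥ w)} := fun t ht w =>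
    (h.isGradientFlow_mulVec w).antitoneOn hg hT (hT.trans ht) ht
  have hcont : Continuous fun A : Matrix ι ι ℝ => |(1 - A).det| :=
    (continuous_const.sub continuous_id).matrix_det.abs
  obtain ⟨A, hA, hmin⟩ := (isCompact_setOf_sq_le (Φ T)).exists_isMinOn ⟨Φ T, hmem T le_rfl⟩
    hcont.continuousOn
  exact ⟨T, |(1 - A).det|, hT, abs_pos.2 (det_one_sub_ne_zero_of_sq_lt fun w hw =>
    (hA w).trans_lt (hlt w hw)), fun t ht => hmin (hmem t ht)⟩

/-- As `Y = Δ θ`, the components of the error decouple. The free rate `κ` serves twice: `0` for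
monotonicity at all times, and `γ δ ^ 2` once `|Δ| ≥ δ`. -/
theorem IsGDEstimator.hasDerivWithinAt_error_sq (h : IsGDEstimator g γ v φ θg Φ θhat)
    (hg : ∀ t, 0 ≤ t → 0 < g t) (hv : LRE v φ θ) (i : ι) (κ : ℝ) {t : ℝ} (ht : 0 ≤ t) :
    HasDerivWithinAt (fun s => Real.exp (2 * κ * s) * (θhat s i - θ i) ^ 2)
      (2 * Real.exp (2 * κ * t) * (θhat t i - θ i) ^ 2 * (κ - γ * gdDelta (Φ t) ^ 2))
      (Set.Ici 0) t := by
  have h1 := ((h.estimate t ht i).sub_const (θ i)).fun_pow 2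
  have h2 : HasDerivWithinAt (fun s : ℝ => Real.exp (2 * κ * s))
      (Real.exp (2 * κ * t) * (2 * κ * 1)) (Set.Ici 0) t :=
    ((hasDerivWithinAt_id t _).const_mul (2 * κ)).exp
  refine (h2.mul h1).congr_deriv ?_
  rw [h.gdY_eq hg hv ht, Pi.smul_apply, smul_eq_mul]
  push_cast
  ring

theorem IsGDEstimator.expConvergesToZero (h : IsGDEstimator g γ v φ θg Φ θhat)
    (hg : ∀ t, 0 ≤ t → 0 < g t) (hγ : 0 < γ) (hv : LRE v φ θ) (hid : Identifiable φ) :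
    ExpConvergesToZero fun t => θhat t - θ := by
  obtain ⟨T, δ, hT, hδ, hΔ⟩ := h.exists_gdDelta_bound hg hid
  set κ := γ * δ ^ 2 with hκ
  have hκ0 : 0 < κ := by positivity
  have hearly : ∀ i t, 0 ≤ t → (θhat t i - θ i) ^ 2 ≤ (θhat 0 i - θ i) ^ 2 := fun i t ht => by
    have := antitoneOn_Ici_of_hasDerivWithinAt
      (fun t ht => h.hasDerivWithinAt_error_sq hg hv i 0 ht) (fun t _ => by
        have : 0 ≤ 2 * Real.exp (2 * 0 * t) * (θhat t i - θ i) ^ 2 * (γ * gdDelta (Φ t) ^ 2) := by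
          positivity
        linarith) (Set.mem_Ici.2 le_rfl) ht ht
    simpa using this
  have hlate : ∀ i t, T ≤ t → Real.exp (2 * κ * t) * (θhat t i - θ i) ^ 2
      ≤ Real.exp (2 * κ * T) * (θhat T i - θ i) ^ 2 := fun i t ht =>
    antitoneOn_Ici_of_hasDerivWithinAt (a := T)
      (fun t ht => (h.hasDerivWithinAt_error_sq hg hv i κ (hT.trans ht)).mono
        (Set.Ici_subset_Ici.2 hT)) (fun t ht => by
        have h1 : δ ^ 2 ≤ gdDelta (Φ t) ^ 2 := by
          rw [← sq_abs (gdDelta (Φ t))]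
          exact pow_le_pow_left₀ hδ.le (hΔ t ht) 2
        have h2 : κ - γ * gdDelta (Φ t) ^ 2 ≤ 0 := by
          have := mul_le_mul_of_nonneg_left h1 hγ.le
          linarith
        exact mul_nonpos_of_nonneg_of_nonpos (by positivity) h2)
      (Set.mem_Ici.2 le_rfl) ht ht
  -- The factor `exp (κ T)` pays for the interval `[0, T]`, where `Δ` may vanish and the error is
  -- only known not to grow.
  refine ⟨Real.exp (κ * T) * ‖θhat 0 - θ‖, κ, hκ0, fun t ht => ?_⟩
  rw [pi_norm_le_iff_of_nonneg (by positivity)]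
  intro i
  have hbound : (θhat t i - θ i) ^ 2
      ≤ (Real.exp (κ * T) * |θhat 0 i - θ i| * Real.exp (-κ * t)) ^ 2 := by
    have e0 : (Real.exp (κ * T) * |θhat 0 i - θ i| * Real.exp (-κ * t)) ^ 2
        = Real.exp (2 * κ * T - 2 * κ * t) * (θhat 0 i - θ i) ^ 2 := by
      rw [mul_pow, mul_pow, sq_abs, ← Real.exp_nat_mul, ← Real.exp_nat_mul, mul_right_comm,
        ← Real.exp_add]
      congr 2
      push_cast
      ring
    rw [e0]
    rcases le_total t T with htT | htT
    · have h1 : 1 ≤ Real.exp (2 * κ * T - 2 * κ * t) := Real.one_le_exp (by nlinarith)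
      nlinarith [hearly i t ht, sq_nonneg (θhat 0 i - θ i)]
    · have h1 := hlate i t htT
      have h2 := hearly i T hT
      have h3 : (θhat t i - θ i) ^ 2
          = Real.exp (-(2 * κ * t)) * (Real.exp (2 * κ * t) * (θhat t i - θ i) ^ 2) := by
        rw [← mul_assoc, ← Real.exp_add, neg_add_cancel, Real.exp_zero, one_mul]
      rw [h3, sub_eq_add_neg (2 * κ * T), Real.exp_add, mul_comm (Real.exp (2 * κ * T)),
        mul_assoc (Real.exp (-(2 * κ * t)))]
      refine mul_le_mul_of_nonneg_left (h1.trans ?_) (Real.exp_pos _).le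
      exact mul_le_mul_of_nonneg_left h2 (Real.exp_pos _).le
  have habs := abs_le_of_sq_le_sq hbound (by positivity)
  change |θhat t i - θ i| ≤ _
  refine habs.trans ?_
  have : |θhat 0 i - θ i| ≤ ‖θhat 0 - θ‖ := norm_le_pi_norm (θhat 0 - θ) i
  gcongr

end Estimator

end

/-! ### A Gronwall inequality and Hurwitz filters -/

section

open Signal

theorem integral_exp_mul {κ : ℝ} (hκ : κ ≠ 0) (t : ℝ) :
    ∫ s in (0 : ℝ)..t, Real.exp (κ * s) = (Real.exp (κ * t) - 1) / κ := by
  rw [intervalIntegral.integral_comp_mul_left (fun s => Real.exp s) hκ, integral_exp, mul_zero,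
    Real.exp_zero, smul_eq_mul]
  field_simp

theorem integral_exp_neg_mul_le {κ : ℝ} (hκ : 0 < κ) (t : ℝ) :
    ∫ s in (0 : ℝ)..t, Real.exp (-κ * s) ≤ 1 / κ := by
  rw [integral_exp_mul (neg_ne_zero.2 hκ.ne'), div_neg, ← neg_div]
  have := Real.exp_pos (-κ * t)
  gcongr
  linarith

/-- A Gronwall inequality with an exponentially decaying kernel. -/
theorem le_of_le_add_integral_exp {z : ℝ → ℝ} {A α b β : ℝ} (hA : 0 ≤ A) (hα : 0 ≤ α) (hb : 0 ≤ b)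
    (hβ : 0 < β) (hzc : ContinuousOn z (Set.Ici 0)) (hz0 : ∀ t, 0 ≤ t → 0 ≤ z t)
    (hz : ∀ t, 0 ≤ t → z t ≤ A * Real.exp (α * t)
      + ∫ s in (0 : ℝ)..t, b * Real.exp (-β * s) * z s) {T : ℝ} (hT : 0 ≤ T) :
    z T ≤ A * Real.exp (b / β) * Real.exp (α * T) := by
  -- Freezing `z` at negative times gives a continuous function on the line, so that the majorant
  -- `R` is differentiable everywhere.
  set ζ : ℝ → ℝ := fun s => z (max s 0) with hζ
  have hζc : Continuous ζ :=
    hzc.comp_continuous (by fun_prop) fun s => le_max_right s 0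
  have hζz : ∀ s, 0 ≤ s → ζ s = z s := fun s hs => by simp [hζ, max_eq_left hs]
  set k : ℝ → ℝ := fun s => b * Real.exp (-β * s) * ζ s with hk
  have hkc : Continuous k := by fun_prop
  have hint : ∀ t, 0 ≤ t → ∫ s in (0 : ℝ)..t, b * Real.exp (-β * s) * z s
      = ∫ s in (0 : ℝ)..t, k s := fun t ht =>
    intervalIntegral.integral_congr fun s hs => by
      rw [Set.uIcc_of_le ht] at hs
      simp only [hk, hζz s hs.1]
  set R : ℝ → ℝ := fun t => A * Real.exp (α * T) + ∫ s in (0 : ℝ)..t, k s with hR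
  have hRd : ∀ t, HasDerivAt R (k t) t := fun t =>
    ((hkc.integral_hasStrictDerivAt 0 t).hasDerivAt).const_add _
  have hR0 : ∀ t ∈ Set.Icc 0 T, ζ t ≤ R t := fun t ht => by
    rw [hζz t ht.1]
    refine (hz t ht.1).trans ?_
    rw [hint t ht.1, hR]
    have : Real.exp (α * t) ≤ Real.exp (α * T) :=
      Real.exp_le_exp.2 (mul_le_mul_of_nonneg_left ht.2 hα)
    have := mul_le_mul_of_nonneg_left this hA
    simp only
    linarith
  -- The integrating factor has logarithmic derivative `-b exp (-β t)`. It starts at `exp (b / β)`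
  -- and never falls below `1`, which gives the constant.
  have hH : AntitoneOn (fun t => R t * Real.exp (b / β * Real.exp (-β * t))) (Set.Icc 0 T) := by
    have hd : ∀ t, HasDerivAt (fun t => R t * Real.exp (b / β * Real.exp (-β * t)))
        (Real.exp (b / β * Real.exp (-β * t)) * (b * Real.exp (-β * t)) * (ζ t - R t)) t :=
      fun t => by
      have h1 : HasDerivAt (fun t : ℝ => Real.exp (-β * t)) (Real.exp (-β * t) * (-β * 1)) t :=
        ((hasDerivAt_id t).const_mul (-β)).exp
      refine ((hRd t).mul (h1.const_mul (b / β)).exp).congr_deriv ?_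
      simp only [hk]
      field_simp
      ring
    refine antitoneOn_of_hasDerivWithinAt_nonpos (convex_Icc 0 T)
      (fun t _ => (hd t).continuousAt.continuousWithinAt) (fun t _ => (hd t).hasDerivWithinAt)
      fun t ht => ?_
    have := hR0 t (interior_subset ht)
    exact mul_nonpos_of_nonneg_of_nonpos (by positivity) (by linarith)
  have h1 := hH (Set.left_mem_Icc.2 hT) (Set.right_mem_Icc.2 hT) hT
  have h2 := hR0 T (Set.right_mem_Icc.2 hT)
  rw [hζz T hT] at h2
  have h3 : 1 ≤ Real.exp (b / β * Real.exp (-β * T)) := Real.one_le_exp (by positivity)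
  have h4 : R 0 = A * Real.exp (α * T) := by simp [hR]
  simp only [h4, mul_zero, Real.exp_zero, mul_one] at h1
  have h5 : 0 ≤ R T := (hz0 T hT).trans h2
  nlinarith

theorem IsHurwitz.mul {p q : ℝ[X]} (hp : IsHurwitz p) (hq : IsHurwitz q) : IsHurwitz (p * q) := by
  intro z hz
  rw [map_mul, mul_eq_zero] at hz
  exact hz.elim (hp z) (hq z)

theorem IsHurwitz.re_neg_of_isRoot_map {p : ℝ[X]} (hp : IsHurwitz p) (z : ℂ)
    (hz : (p.map Complex.ofRealHom).IsRoot z) : z.re < 0 := by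
  refine hp z ?_
  rwa [IsRoot, eval_map] at hz

namespace Signal

variable {w : ℝ → ℝ}

theorem expDominated_congr_norm {f g : Signal} (hf : ExpDominated w f)
    (h : ∀ t, 0 ≤ t → ‖g.1 t‖ = ‖f.1 t‖) : ExpDominated w g := by
  obtain ⟨c, α, hc, hα, hf⟩ := hf
  exact ⟨c, α, hc, hα, fun t ht => by rw [h t ht]; exact hf t ht⟩

theorem ExpDominated.of_rev_smul_pow (hw : ∀ t, 0 ≤ t → 0 ≤ w t)
    (hwi : LocallyIntegrableNonneg w) {d : ℕ} {p : ℝ[X]} (hp : p.Monic)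
    (hd : p.natDegree = d) (hH : IsHurwitz p) {y f g : Signal} {j k : ℕ} {s : ℂ[X]}
    (hj : j ≤ d) (hk : k ≤ d) (hf : ExpDominated w f) (hg : ExpDominated w g)
    (hs : s ∈ degreeLT ℂ d)
    (h : rev d p • y = (X ^ j : ℂ[X]) • f + (X ^ k : ℂ[X]) • g + s • step) :
    ExpDominated w y := by
  refine ExpDominated.of_stable hw hwi (hp.map Complex.ofRealHom) (by rw [natDegree_map, hd])
    hH.re_neg_of_isRoot_map (V := 0) (q := 0) (s := s)
    (g := fun i => (if i = j then f else 0) + (if i = k then g else 0)) (fun i _ => ?_)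
    (fun t ht => by change ‖(0 : ℂ)‖ ≤ _; simpa using hw t ht) (zero_mem _) hs ?_
  · refine ExpDominated.add hw hwi ?_ ?_
    · split_ifs
      · exact hf
      · exact ExpDominated.zero
    · split_ifs
      · exact hg
      · exact ExpDominated.zero
  · change rev d p • y = _
    rw [h]
    simp only [smul_add, smul_ite, smul_zero, Finset.sum_add_distrib, Finset.sum_ite_eq',
      Finset.mem_range, Nat.lt_succ_of_le hj, Nat.lt_succ_of_le hk, if_true]
    simp

theorem ExpDominated.of_rev_smul (hw : ∀ t, 0 ≤ t → 0 ≤ w t)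
    (hwi : LocallyIntegrableNonneg w) {d : ℕ} {p : ℝ[X]} (hp : p.Monic)
    (hd : p.natDegree = d) (hH : IsHurwitz p) {y V : Signal} {q s : ℂ[X]}
    (hV : ∀ t, 0 ≤ t → ‖V.1 t‖ ≤ w t) (hq : q ∈ degreeLT ℂ d) (hs : s ∈ degreeLT ℂ d)
    (h : rev d p • y = (X * q) • V + s • step) : ExpDominated w y := by
  refine ExpDominated.of_stable hw hwi (hp.map Complex.ofRealHom) (by rw [natDegree_map, hd])
    hH.re_neg_of_isRoot_map (V := V) (q := q) (s := s) (g := 0)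
    (fun i _ => ExpDominated.zero) hV hq hs ?_
  change rev d p • y = _
  rw [h]
  simp

/-- Strict properness in reversed form: a degree deficit of one in `q` appears as a factor `X`, as
required for an input bounded only pointwise. -/
theorem rev_mul_rev_eq_X_mul {n : ℕ} (hn : 0 < n) {q lam : ℝ[X]} (hq : q.natDegree ≤ n - 1)
    (hlam : lam.natDegree ≤ n - 1) :
    ∃ Q ∈ degreeLT ℂ (n - 1 + n), rev n q * rev (n - 1) lam = X * Q := by
  refine ⟨rev (n - 1) q * rev (n - 1) lam, ?_, ?_⟩
  · have : (rev (n - 1) q * rev (n - 1) lam).natDegree ≤ n - 1 + (n - 1) :=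
      natDegree_mul_le.trans (add_le_add (natDegree_rev_le hq) (natDegree_rev_le hlam))
    rw [mem_degreeLT]
    refine degree_le_natDegree.trans_lt ?_
    exact_mod_cast (by omega)
  · have : rev n q = X * rev (n - 1) q := by
      conv_lhs => rw [show n = 1 + (n - 1) by omega, rev_add_left hq, pow_one]
    rw [this, mul_assoc]

end Signal

end

/-! ### Bounded regressor and exponential tracking -/

section

open Signal

section Tracking

variable {n m : ℕ} {D N Dm lam a b : ℝ[X]} {kp km c : ℝ}
  {u y r ym : ℝ → ℝ} {φPE φIE : ℝ → ParamIdx n → ℝ} {uIE : ℝ → ℝ}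

/-- The regressor is bounded in terms of the control error and the reference. -/
theorem MRACSignals.phiPE_dominated
    (h : MRACSignals (SystemResponse false) n D N Dm lam kp km u y r ym φPE φIE uIE)
    (hmn : m < n) (hD : D.Monic) (hDdeg : D.natDegree = n) (hN : N.Monic) (hNdeg : N.natDegree = m)
    (hNH : IsHurwitz N) (hDm : Dm.Monic) (hDmdeg : Dm.natDegree = n - m) (hDmH : IsHurwitz Dm)
    (hlam : lam.Monic) (hlamdeg : lam.natDegree = n - 1) (hlamH : IsHurwitz lam)
    (ha : a ∈ degreeLT ℝ (n - 1)) (hb : b ∈ degreeLT ℝ (n - 1))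
    (hmatch : (lam - a) * D - (b + C c * lam) * (C kp * N) = Dm * lam * N) {c' : ℝ}
    {w : ℝ → ℝ} (hw : ∀ t, 0 ≤ t → 0 ≤ w t) (hwi : LocallyIntegrableNonneg w)
    (hwv : ∀ t, 0 ≤ t → |u t - matchingParam n a b c c' ⬝ᵥ φPE t + c' * r t| ≤ w t)
    (k : ParamIdx n) (hk : k ≠ Sum.inr 1) :
    ExpDominated w (ofReal (fun t => φPE t k) (h.locallyIntegrable_phiPE k)) := by
  have hu : LocallyIntegrableNonneg u := h.plant.locallyIntegrable_input
  have hy : LocallyIntegrableNonneg y := h.plant.locallyIntegrable_output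
  have hr : LocallyIntegrableNonneg r := h.model.locallyIntegrable_input
  have hv := h.locallyIntegrable_input_error (matchingParam n a b c c')
  have hqdeg : (C kp * N).natDegree < n :=
    (natDegree_C_mul_le _ _).trans_lt (hNdeg.trans_lt hmn)
  have hpm : (Dm * lam * N).Monic := (hDm.mul hlam).mul hN
  have hpdeg : (Dm * lam * N).natDegree = n - 1 + n := by
    rw [(hDm.mul hlam).natDegree_mul hN, hDm.natDegree_mul hlam, hDmdeg, hlamdeg, hNdeg]
    omega
  have hpH : IsHurwitz (Dm * lam * N) := (hDmH.mul hlamH).mul hNH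
  obtain ⟨ξ, σ, hξ, huξ, hyξ⟩ := h.plant.exists_chain hD hDdeg hqdeg hu hy
  obtain ⟨S, l, hl, hS, hG⟩ := h.closedLoop hDdeg (by omega) hlam hlamdeg ha hb hmatch hu hy hr hv
    hξ huξ hyξ
  have hGw : ∀ t, 0 ≤ t → ‖(ofReal _ hv + (C (c' : ℂ) : ℂ[X]) • ofReal r hr).1 t‖ ≤ w t :=
    fun t ht => by
    rw [Signal.add_apply, C_smul_apply, ofReal_apply _ ht, ofReal_apply _ ht, ← Complex.ofReal_mul,
      ← Complex.ofReal_add, Complex.norm_real]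
    exact hwv t ht
  -- The map from `v + c' r` to `q(P) ξ` is `q lam / (Dm lam N)`, strictly proper and stable. It
  -- yields the plant output and all derivatives of `ξ` of order below `n`.
  have hout : ∀ q : ℝ[X], q.natDegree ≤ n - 1 → ExpDominated w
      (∑ j ∈ Finset.range (n + 1), (C (q.coeff j : ℂ) : ℂ[X]) • ξ j) := fun q hq => by
    obtain ⟨s, hs, hq'⟩ := closedLoop_output hpdeg.le (hq.trans (by omega)) hξ hl hS hG
    obtain ⟨Q, hQ, hQq⟩ := rev_mul_rev_eq_X_mul (by omega) hq hlamdeg.le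
    rw [hQq] at hq'
    exact ExpDominated.of_rev_smul hw hwi hpm hpdeg hpH hGw hQ (transient_le_degreeLT _ _ hs) hq'
  have hYd : ExpDominated w (ofReal y hy) := by
    rw [hyξ]
    exact hout _ (by omega)
  have hξd : ∀ i < n, ExpDominated w (ξ i) := fun i hi => by
    have := hout (X ^ i) (by rw [natDegree_X_pow]; omega)
    rw [Finset.sum_eq_single_of_mem i (Finset.mem_range.2 (by omega))
      fun j _ hj => by rw [coeff_X_pow, if_neg hj, Complex.ofReal_zero, C_0, zero_smul],
      coeff_X_pow, if_pos rfl, Complex.ofReal_one, C_1, one_smul] at this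
    exact this
  rcases k with (i | i) | i
  · obtain ⟨s, hs, hφ⟩ := (h.phiPE_input i).rev_smul_eq hlam hlamdeg
      (by rw [natDegree_X_pow]; omega) hu (h.phiPE_input i).locallyIntegrable_output
    have hi : (i : ℕ) < n - 1 := i.2
    -- The input contains the top derivative `ξ n`, which is not dominated. Since `i ≤ n - 2`, the
    -- filter integrates it at least once, and `X • ξ n` is `ξ (n - 1)` up to its initial value.
    obtain ⟨e, he, hee⟩ := hξ.succ (n - 1) (by omega)
    rw [show n - 1 + 1 = n by omega] at hee
    have hlead : D.coeff n = 1 := by rw [← hDdeg]; exact hD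
    rw [rev_X_pow hi.le, huξ, Finset.sum_range_succ, hlead,
      Complex.ofReal_one, C_1, one_smul] at hφ
    have hd : ExpDominated w (∑ j ∈ Finset.range n, (C (D.coeff j : ℂ) : ℂ[X]) • ξ j) :=
      ExpDominated.sum hw hwi _ fun j hj => (hξd j (Finset.mem_range.1 hj)).C_smul _
    refine ExpDominated.of_rev_smul_pow hw hwi hlam hlamdeg hlamH (j := n - 1 - i)
      (k := n - 1 - (i + 1)) (s := s - X ^ (n - 1 - (i + 1)) * e) (by omega) (by omega) hd
      (hξd (n - 1) (by omega)) (sub_mem (transient_le_degreeLT _ _ hs)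
        (transient_le_degreeLT false _ (transient_mono (by omega : n - 1 - (i + 1) + 1 ≤ n - 1)
        (mul_mem_transient (natDegree_X_pow_le _) he)))) ?_
    rw [hφ, hee, show n - 1 - (i : ℕ) = n - 1 - (i + 1) + 1 by omega, pow_succ]
    module
  · obtain ⟨s, hs, hφ⟩ := (h.phiPE_output i).rev_smul_eq hlam hlamdeg
      (by rw [natDegree_X_pow]; omega) hy (h.phiPE_output i).locallyIntegrable_output
    have hi : (i : ℕ) < n - 1 := i.2
    rw [rev_X_pow hi.le] at hφ
    refine ExpDominated.of_rev_smul_pow hw hwi hlam hlamdeg hlamH (j := n - 1 - i)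
      (k := n - 1 - i) (s := s) (by omega) (by omega) hYd ExpDominated.zero
      (transient_le_degreeLT _ _ hs) ?_
    rw [hφ, smul_zero, add_zero]
  · fin_cases i
    · refine expDominated_congr_norm hYd fun t ht => ?_
      rw [ofReal_apply _ ht, ofReal_apply _ ht]
      exact congrArg (fun x : ℝ => ‖(x : ℂ)‖) (h.phiPE_y t ht)
    · exact absurd rfl hk

/-- The tracking error is bounded in terms of the control error. -/
theorem MRACSignals.error_dominated
    (h : MRACSignals (SystemResponse false) n D N Dm lam kp km u y r ym φPE φIE uIE)
    (hmn : m < n) (hD : D.Monic) (hDdeg : D.natDegree = n) (hN : N.Monic) (hNdeg : N.natDegree = m)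
    (hkp : kp ≠ 0)
    (hNH : IsHurwitz N) (hDm : Dm.Monic) (hDmdeg : Dm.natDegree = n - m) (hDmH : IsHurwitz Dm)
    (hlam : lam.Monic) (hlamdeg : lam.natDegree = n - 1) (hlamH : IsHurwitz lam)
    (ha : a ∈ degreeLT ℝ (n - 1)) (hb : b ∈ degreeLT ℝ (n - 1))
    (hmatch : (lam - a) * D - (b + C c * lam) * (C kp * N) = Dm * lam * N)
    (hy : LocallyIntegrableNonneg y) (hym : LocallyIntegrableNonneg ym) :
    ExpDominated (fun t => |u t - matchingParam n a b c (km / kp) ⬝ᵥ φPE t|)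
      (ofReal y hy - ofReal ym hym) := by
  have hu : LocallyIntegrableNonneg u := h.plant.locallyIntegrable_input
  have hr : LocallyIntegrableNonneg r := h.model.locallyIntegrable_input
  have hv := h.locallyIntegrable_input_error (matchingParam n a b c (km / kp))
  have hqdeg : (C kp * N).natDegree < n :=
    (natDegree_C_mul_le _ _).trans_lt (hNdeg.trans_lt hmn)
  have hpm : (Dm * lam * N).Monic := (hDm.mul hlam).mul hN
  have hpdeg : (Dm * lam * N).natDegree = n - 1 + n := by
    rw [(hDm.mul hlam).natDegree_mul hN, hDm.natDegree_mul hlam, hDmdeg, hlamdeg, hNdeg]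
    omega
  have hpH : IsHurwitz (Dm * lam * N) := (hDmH.mul hlamH).mul hNH
  obtain ⟨ξ, σ, hξ, huξ, hyξ⟩ := h.plant.exists_chain hD hDdeg hqdeg hu hy
  obtain ⟨S, l, hl, hS, hG⟩ := h.closedLoop hDdeg (by omega) hlam hlamdeg ha hb hmatch hu hy hr hv
    hξ huξ hyξ
  obtain ⟨s, hs, hY⟩ := closedLoop_output hpdeg.le hqdeg.le hξ hl hS hG
  rw [← hyξ] at hY
  obtain ⟨s', hs', hM⟩ := h.model.rev_smul_eq hDm hDmdeg (by rw [natDegree_C]; omega) hr hym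
  obtain ⟨Q, hQ, hQq⟩ := rev_mul_rev_eq_X_mul (n := n) (q := C kp * N) (by omega) (by omega)
    hlamdeg.le
  have hlN : (lam * N).natDegree ≤ n - 1 + m :=
    natDegree_mul_le.trans (add_le_add hlamdeg.le hNdeg.le)
  have hK : n - 1 + n = n - 1 + m + (n - m) := by omega
  have e1 : rev (n - 1 + n) (Dm * lam * N) = rev (n - 1 + m) (lam * N) * rev (n - m) Dm := by
    rw [hK, ← rev_mul hlN hDmdeg.le]
    congr 1; ring
  have hkk : (C (km : ℂ) : ℂ[X]) = C (kp : ℂ) * C ((km / kp : ℝ) : ℂ) := by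
    rw [← C_mul, ← Complex.ofReal_mul, mul_div_cancel₀ _ hkp]
  have e2 : rev (n - 1 + m) (lam * N) * rev (n - m) (C km)
      = C ((km / kp : ℝ) : ℂ) * (rev n (C kp * N) * rev (n - 1) lam) := by
    have h1 : rev (n - m) (C km) = C (km : ℂ) * X ^ (n - m) := by
      rw [← mul_one (C km), rev_C_mul, rev_one]
    have h2 : rev n (C kp * N) = C (kp : ℂ) * (X ^ (n - m) * rev m N) := by
      rw [rev_C_mul, ← rev_add_left hNdeg.le, Nat.sub_add_cancel hmn.le]
    rw [h1, h2, hkk, rev_mul hlamdeg.le hNdeg.le]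
    ring
  -- The model is brought to the denominator of the closed loop, where the reference enters with the
  -- same coefficient and disappears from the difference.
  have hM' : rev (n - 1 + n) (Dm * lam * N) • ofReal ym hym
      = (C ((km / kp : ℝ) : ℂ) * (rev n (C kp * N) * rev (n - 1) lam)) • ofReal r hr
        + (rev (n - 1 + m) (lam * N) * s') • step := by
    rw [e1, mul_smul, hM, ← e2]
    module
  have hs'' : rev (n - 1 + m) (lam * N) * s' ∈ degreeLT ℂ (n - 1 + n) := by
    rw [hK]
    exact transient_le_degreeLT false _ (mul_mem_transient (natDegree_rev_le hlN) hs')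
  refine ExpDominated.of_rev_smul (fun t _ => abs_nonneg _)
    (fun T hT => (hv T hT).abs) hpm hpdeg hpH
    (V := ofReal _ hv) (q := Q) (s := s - rev (n - 1 + m) (lam * N) * s') (fun t ht => ?_) hQ
    (sub_mem (transient_le_degreeLT _ _ hs) hs'') ?_
  · rw [ofReal_apply _ ht, Complex.norm_real]
    exact le_rfl
  · rw [smul_sub, hY, hM', ← hQq]
    module

theorem abs_dotProduct_le {ι : Type*} [Fintype ι] [DecidableEq ι] (k : ι) (θ φ : ι → ℝ) {B : ℝ}
    (hB : |φ k| ≤ B) : |θ ⬝ᵥ φ| ≤ ‖θ‖ * ((∑ j ∈ Finset.univ.erase k, |φ j|) + B) := by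
  have h1 : ∑ j, |φ j| ≤ (∑ j ∈ Finset.univ.erase k, |φ j|) + B := by
    rw [← Finset.sum_erase_add _ _ (Finset.mem_univ k)]
    linarith
  refine (Finset.abs_sum_le_sum_abs _ _).trans ?_
  calc ∑ j, |θ j * φ j| ≤ ∑ j, ‖θ‖ * |φ j| := Finset.sum_le_sum fun j _ => by
        rw [abs_mul]
        exact mul_le_mul_of_nonneg_right (norm_le_pi_norm θ j) (abs_nonneg _)
    _ = ‖θ‖ * ∑ j, |φ j| := by rw [Finset.mul_sum]
    _ ≤ _ := mul_le_mul_of_nonneg_left h1 (norm_nonneg _)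

/-- Exponential tracking under certainty equivalence control with an exponentially convergent
estimate. -/
theorem MRACSignals.error_expConvergesToZero
    (h : MRACSignals (SystemResponse false) n D N Dm lam kp km u y r ym φPE φIE uIE)
    (hmn : m < n) (hD : D.Monic) (hDdeg : D.natDegree = n) (hN : N.Monic) (hNdeg : N.natDegree = m)
    (hkp : kp ≠ 0)
    (hNH : IsHurwitz N) (hDm : Dm.Monic) (hDmdeg : Dm.natDegree = n - m) (hDmH : IsHurwitz Dm)
    (hlam : lam.Monic) (hlamdeg : lam.natDegree = n - 1) (hlamH : IsHurwitz lam)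
    (ha : a ∈ degreeLT ℝ (n - 1)) (hb : b ∈ degreeLT ℝ (n - 1))
    (hmatch : (lam - a) * D - (b + C c * lam) * (C kp * N) = Dm * lam * N)
    {θhat : ℝ → ParamIdx n → ℝ}
    (hθ : ExpConvergesToZero fun t => θhat t - matchingParam n a b c (km / kp))
    (hcontrol : ∀ t, 0 ≤ t → u t = θhat t ⬝ᵥ φPE t) :
    ExpConvergesToZero fun t => y t - ym t := by
  set θ := matchingParam n a b c (km / kp) with hθdef
  obtain ⟨B, hB⟩ := h.ref_bounded
  obtain ⟨c₁, β, hβ, hθ⟩ := hθ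
  have hB0 : 0 ≤ B := (abs_nonneg _).trans (hB 0 le_rfl)
  have hc₁ : 0 ≤ c₁ := by
    have := (norm_nonneg _).trans (hθ 0 le_rfl)
    simpa using this
  have hv := h.locallyIntegrable_input_error θ
  set k₀ : ParamIdx n := Sum.inr 1
  -- The reference entry is left out: it is bounded by `B` but need not be continuous, whereas the
  -- Gronwall argument needs a continuous function.
  set Ψ : ℝ → ℝ := fun t => ∑ k ∈ Finset.univ.erase k₀, |φPE t k| with hΨ
  have hΨ0 : ∀ t, 0 ≤ Ψ t := fun t => Finset.sum_nonneg fun _ _ => abs_nonneg _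
  have hΨc : ContinuousOn Ψ (Set.Ici 0) := by
    refine continuousOn_finsetSum _ fun k hk => ContinuousOn.abs ?_
    rcases k with (i | i) | i
    · exact (h.phiPE_input i).continuousOn_output
    · exact (h.phiPE_output i).continuousOn_output
    · fin_cases i
      · exact h.plant.continuousOn_output.congr fun t ht => h.phiPE_y t ht
      · exact absurd rfl (Finset.ne_of_mem_erase hk)
  have hvΨ : ∀ t, 0 ≤ t → |u t - θ ⬝ᵥ φPE t| ≤ c₁ * Real.exp (-β * t) * (Ψ t + B) := fun t ht => by
    rw [hcontrol t ht, ← sub_dotProduct]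
    refine (abs_dotProduct_le (B := B) k₀ (θhat t - θ) (φPE t) (by
      rw [h.phiPE_r t ht]; exact hB t ht)).trans ?_
    exact mul_le_mul_of_nonneg_right (hθ t ht) (add_nonneg (hΨ0 t) hB0)
  set B' := |km / kp| * B with hB'
  have hB'0 : 0 ≤ B' := by positivity
  set w : ℝ → ℝ := fun t => |u t - θ ⬝ᵥ φPE t| + B' with hwdef
  have hw : ∀ t, 0 ≤ t → 0 ≤ w t := fun t _ => add_nonneg (abs_nonneg _) hB'0
  have hwi : LocallyIntegrableNonneg w := fun T hT => (hv T hT).abs.add intervalIntegrable_const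
  have hΨd : ExpDominated w (ofReal Ψ hΨc.locallyIntegrableNonneg) := by
    have hki : ∀ k, LocallyIntegrableNonneg fun t => |φPE t k| := fun k T hT =>
      (h.locallyIntegrable_phiPE k T hT).abs
    have : ofReal Ψ hΨc.locallyIntegrableNonneg
        = ∑ k ∈ Finset.univ.erase k₀, ofReal (fun t => |φPE t k|) (hki k) := by
      refine ext_nonneg fun t ht => ?_
      rw [ofReal_apply _ ht, Signal.sum_apply]
      simp only [ofReal_apply _ ht, hΨ]
      push_cast
      rfl
    rw [this]
    refine ExpDominated.sum hw hwi _ fun k hk => ?_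
    refine expDominated_congr_norm (h.phiPE_dominated hmn hD hDdeg hN hNdeg hNH hDm hDmdeg hDmH hlam
      hlamdeg hlamH ha hb hmatch (c' := km / kp) hw hwi (fun t ht => ?_) k
      (Finset.ne_of_mem_erase hk)) fun t ht => ?_
    · refine (abs_add_le _ _).trans (add_le_add le_rfl ?_)
      rw [abs_mul]
      exact mul_le_mul_of_nonneg_left (hB t ht) (abs_nonneg _)
    · rw [ofReal_apply _ ht, ofReal_apply _ ht, Complex.norm_real, Complex.norm_real, norm_abs_eq_norm]
  obtain ⟨c₂, α, hc₂, hα, hΨw⟩ := hΨd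
  set M := c₁ * B + B' with hM
  have hM0 : 0 ≤ M := by positivity
  -- Inserting `w ≤ M + c₁ exp (-β s) Ψ` closes the loop. The coupling has a decaying kernel, so the
  -- Gronwall factor is a constant and `Ψ` is bounded however large the initial estimation error is.
  have hgron : ∀ t, 0 ≤ t → Real.exp (α * t) * Ψ t ≤ c₂ * (1 + M / α) * Real.exp (α * t)
      + ∫ s in (0 : ℝ)..t, c₂ * c₁ * Real.exp (-β * s) * (Real.exp (α * s) * Ψ s) := fun t ht => by
    have h1 := hΨw t ht
    rw [ofReal_apply _ ht, Complex.norm_real, Real.norm_of_nonneg (hΨ0 t)] at h1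
    have hi1 : IntervalIntegrable (fun s => M * Real.exp (α * s)) MeasureTheory.volume 0 t :=
      Continuous.intervalIntegrable (by fun_prop) _ _
    have hi2 : IntervalIntegrable (fun s => c₁ * Real.exp (-β * s) * (Real.exp (α * s) * Ψ s))
        MeasureTheory.volume 0 t :=
      ((hΨc.locallyIntegrableNonneg t ht).continuousOn_mul (by fun_prop)).continuousOn_mul
        (by fun_prop)
    have h2 : ∫ s in (0 : ℝ)..t, Real.exp (α * s) * w s
        ≤ ∫ s in (0 : ℝ)..t, (M * Real.exp (α * s)
          + c₁ * Real.exp (-β * s) * (Real.exp (α * s) * Ψ s)) := by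
      refine intervalIntegral.integral_mono_on ht (exp_mul_weight_integrable hwi α ht)
        (hi1.add hi2) fun s hs => ?_
      have h3 := hvΨ s hs.1
      have h4 : Real.exp (-β * s) ≤ 1 := Real.exp_le_one_iff.2 (by nlinarith [hs.1])
      have h5 : w s ≤ M + c₁ * Real.exp (-β * s) * Ψ s := by
        have : c₁ * B * Real.exp (-β * s) ≤ c₁ * B * 1 :=
          mul_le_mul_of_nonneg_left h4 (mul_nonneg hc₁ hB0)
        simp only [hwdef, hM]
        linarith
      have := mul_le_mul_of_nonneg_left h5 (Real.exp_pos (α * s)).le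
      linarith
    rw [intervalIntegral.integral_add hi1 hi2, intervalIntegral.integral_const_mul,
      integral_exp_mul hα.ne'] at h2
    have h6 : M * ((Real.exp (α * t) - 1) / α) ≤ M / α * Real.exp (α * t) := by
      have : M * ((Real.exp (α * t) - 1) / α) = M / α * Real.exp (α * t) - M / α := by ring
      rw [this]
      have : 0 ≤ M / α := by positivity
      linarith
    have h7 : ∫ s in (0 : ℝ)..t, c₂ * c₁ * Real.exp (-β * s) * (Real.exp (α * s) * Ψ s)
        = c₂ * ∫ s in (0 : ℝ)..t, c₁ * Real.exp (-β * s) * (Real.exp (α * s) * Ψ s) := by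
      rw [← intervalIntegral.integral_const_mul]
      congr 1
      funext s
      ring
    rw [h7]
    have h8 : 1 ≤ Real.exp (α * t) := Real.one_le_exp (by positivity)
    refine h1.trans ?_
    rw [mul_assoc, ← mul_add]
    refine mul_le_mul_of_nonneg_left ?_ hc₂
    linarith
  have hΨb : ∀ t, 0 ≤ t → Ψ t ≤ c₂ * (1 + M / α) * Real.exp (c₂ * c₁ / β) := fun t ht => by
    have := le_of_le_add_integral_exp (z := fun s => Real.exp (α * s) * Ψ s) (by positivity) hα.le
      (mul_nonneg hc₂ hc₁) hβ (ContinuousOn.mul (by fun_prop) hΨc)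
      (fun s _ => mul_nonneg (Real.exp_pos _).le (hΨ0 s)) hgron ht
    rw [mul_comm] at this
    exact le_of_mul_le_mul_right this (Real.exp_pos _)
  set A := c₂ * (1 + M / α) * Real.exp (c₂ * c₁ / β) with hA
  have hA0 : 0 ≤ A := (hΨ0 0).trans (hΨb 0 le_rfl)
  have hvb : ∀ t, 0 ≤ t → |u t - θ ⬝ᵥ φPE t| ≤ c₁ * (A + B) * Real.exp (-β * t) := fun t ht => by
    refine (hvΨ t ht).trans ?_
    have := mul_le_mul_of_nonneg_left (add_le_add_left (hΨb t ht) B)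
      (mul_nonneg hc₁ (Real.exp_pos (-β * t)).le)
    linarith
  have hy : LocallyIntegrableNonneg y := h.plant.locallyIntegrable_output
  have hym : LocallyIntegrableNonneg ym := h.model.locallyIntegrable_output
  obtain ⟨c₃, α₃, hc₃, hα₃, hE⟩ := h.error_dominated hmn hD hDdeg hN hNdeg hkp hNH hDm hDmdeg hDmH
    hlam hlamdeg hlamH ha hb hmatch hy hym
  -- A rate of at most `β / 2` makes `exp (δ s) |v s|` decay at least like `exp (-(β / 2) s)`, so
  -- its integral is bounded uniformly in time.
  set δ := min α₃ (β / 2) with hδ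
  have hδ0 : 0 < δ := lt_min hα₃ (by positivity)
  have hδβ : δ ≤ β / 2 := min_le_right _ _
  refine ⟨c₃ * (1 + c₁ * (A + B) * (1 / (β / 2))), δ, hδ0, fun t ht => ?_⟩
  have h1 := expDominated_of_le_rate (fun t _ => abs_nonneg _) (fun T hT => (hv T hT).abs) hc₃
    (min_le_left α₃ (β / 2)) ht (hE t ht)
  have h2 : ∫ s in (0 : ℝ)..t, Real.exp (δ * s) * |u s - θ ⬝ᵥ φPE s|
      ≤ c₁ * (A + B) * (1 / (β / 2)) := by
    have hcA : 0 ≤ c₁ * (A + B) := by positivity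
    calc ∫ s in (0 : ℝ)..t, Real.exp (δ * s) * |u s - θ ⬝ᵥ φPE s|
        ≤ ∫ s in (0 : ℝ)..t, c₁ * (A + B) * Real.exp (-(β / 2) * s) := by
          refine intervalIntegral.integral_mono_on ht
            (exp_mul_weight_integrable (fun T hT => (hv T hT).abs) δ ht)
            (Continuous.intervalIntegrable (by fun_prop) _ _) fun s hs => ?_
          have h3 := mul_le_mul_of_nonneg_left (hvb s hs.1) (Real.exp_pos (δ * s)).le
          refine h3.trans ?_
          rw [mul_left_comm, ← Real.exp_add]
          refine mul_le_mul_of_nonneg_left (Real.exp_le_exp.2 ?_) hcA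
          nlinarith [hs.1]
      _ = c₁ * (A + B) * ∫ s in (0 : ℝ)..t, Real.exp (-(β / 2) * s) := by
          rw [intervalIntegral.integral_const_mul]
      _ ≤ _ := mul_le_mul_of_nonneg_left (integral_exp_neg_mul_le (by positivity) t) hcA
  rw [Signal.sub_apply, ofReal_apply _ ht, ofReal_apply _ ht, ← Complex.ofReal_sub,
    Complex.norm_real] at h1
  have h3 := h1.trans (mul_le_mul_of_nonneg_left (add_le_add_right h2 1) hc₃)
  have h4 : ‖y t - ym t‖ = Real.exp (-δ * t) * (Real.exp (δ * t) * ‖y t - ym t‖) := by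
    rw [← mul_assoc, ← Real.exp_add]
    simp
  rw [h4, mul_comm (Real.exp (-δ * t))]
  exact mul_le_mul_of_nonneg_right h3 (Real.exp_pos _).le

end Tracking

end

theorem proposition6
    (n m : ℕ) (hmn : m < n)
    (D N Dm lam : ℝ[X]) (kp km : ℝ)
    (hD : D.Monic) (hDdeg : D.natDegree = n)
    (hN : N.Monic) (hNdeg : N.natDegree = m)
    (hcop : IsCoprime D N) (hkp : kp ≠ 0)
    (hNH : IsHurwitz N)
    (hDm : Dm.Monic) (hDmdeg : Dm.natDegree = n - m) (hDmH : IsHurwitz Dm) (hkm : km ≠ 0)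
    (hlam : lam.Monic) (hlamdeg : lam.natDegree = n - 1) (hlamH : IsHurwitz lam) :
    ∃ θ : ParamIdx n → ℝ,
      (∀ (u y r ym : ℝ → ℝ) (φPE φIE : ℝ → ParamIdx n → ℝ) (uIE : ℝ → ℝ),
        MRACSignals ZeroStateResponse n D N Dm lam kp km u y r ym φPE φIE uIE →
          ZeroStateResponse (C kp) Dm (fun t => u t - θ ⬝ᵥ φPE t) (fun t => y t - ym t) ∧
          LRE uIE φIE θ) ∧
      (∀ (u y r ym : ℝ → ℝ) (φPE φIE : ℝ → ParamIdx n → ℝ) (uIE : ℝ → ℝ),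
        MRACSignals Response n D N Dm lam kp km u y r ym φPE φIE uIE →
        LRE uIE φIE θ →
        Identifiable φIE →
        ∀ (γg : ℝ → ℝ) (γ : ℝ), (∀ t : ℝ, 0 ≤ t → 0 < γg t) → 0 < γ →
        ∀ (θg : ℝ → ParamIdx n → ℝ) (Φ : ℝ → Matrix (ParamIdx n) (ParamIdx n) ℝ)
          (θhat : ℝ → ParamIdx n → ℝ),
        IsGDEstimator γg γ uIE φIE θg Φ θhat →
          ExpConvergesToZero (fun t => θhat t - θ) ∧
          ((∀ t : ℝ, 0 ≤ t → u t = θhat t ⬝ᵥ φPE t) →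
            ExpConvergesToZero (fun t => y t - ym t))) := by
  obtain ⟨a, b, c, ha, hb, hmatch⟩ := exists_matching_polynomials hmn hD hDdeg hN hNdeg hkp hDm
    hDmdeg hlam hlamdeg
  refine ⟨matchingParam n a b c (km / kp), fun u y r ym φPE φIE uIE h => ?_,
    fun u y r ym φPE φIE uIE h hlre hid γg γ hγg hγ θg Φ θhat hest => ?_⟩
  · have h' := h.mono fun _ _ _ _ => ZeroStateResponse.systemResponse
    exact ⟨h'.error_zeroStateResponse hmn hD hDdeg hNdeg hkp hDm hDmdeg hlam hlamdeg ha hb hmatch,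
      h'.lre_of_zeroState hmn hD hDdeg hNdeg hkp hkm hDm hDmdeg hlam hlamdeg ha hb hmatch⟩
  · have hconv := hest.expConvergesToZero hγg hγ hlre hid
    have h' := h.mono fun _ _ _ _ => Response.systemResponse
    exact ⟨hconv, h'.error_expConvergesToZero hmn hD hDdeg hN hNdeg hkp hNH hDm hDmdeg hDmH hlam
      hlamdeg hlamH ha hb hmatch hconv⟩
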